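/- Double categories and double functors are pseudo unless stated otherwise. For a category $\mathcal S$ with pullbacks, $\mathbb{S}\mathsf{pan}(\mathcal S)$ is the double category whose objects and arrows are those of $\mathcal S$, whose proarrows are spans in $\mathcal S$ (composed externally by pullback), and whose cells are maps of spans; $\mathbb{S}\mathsf{pan}$ and $\mathbb{F}\mathsf{in}\mathbb{S}\mathsf{pan}$ are the cases where $\mathcal S$ is the category of sets and of finite sets, respectively. For a double category $\mathbb D$, the double category of families $\mathbb{F}\mathsf{am}(\mathbb D)$ has as objects pairs $(I,\vec x)$ of a (small) set $I$ and a family $(x_i)_{i\in I}$ of objects of $\mathbb D$; as arrows $(I,\vec x)\to(J,\vec y)$, functions $f_0\colon I\to J$ together with arrows $f_i\colon x_i\to y_{f_0(i)}$ of $\mathbb D$; as proarrows $(I,\vec x)\to(J,\vec y)$, spans of sets $I\xleftarrow{\ell}A\xrightarrow{r}J$ together with proarrows $m_a\colon x_{\ell(a)}\to y_{r(a)}$ of $\mathbb D$ for $a\in A$; and as cells $(A,\vec m)\to(B,\vec n)$ with boundary arrows $(f_0,f)$ and $(g_0,g)$, maps of spans $(f_0,\alpha_0,g_0)$ together with cells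 $\alpha_a\colon m_a\to n_{\alpha_0(a)}$ of $\mathbb D$ with boundary arrows $f_{\ell(a)}$ and $g_{r(a)}$. Proarrows are composed externally by composing the indexing spans by pullback and the proarrows of $\mathbb D$ componentwise. The double category $\mathbb{F}\mathsf{in}\mathbb{F}\mathsf{am}(\mathbb D)$ is defined in the same way with all indexing sets (including the apexes of the spans) finite. Let $\Delta\colon\mathbb D\to\mathbb{F}\mathsf{am}(\mathbb D)$ (respectively $\Delta\colon\mathbb D\to\mathbb{F}\mathsf{in}\mathbb{F}\mathsf{am}(\mathbb D)$) be the double functor sending objects and proarrows to singleton families. One says that $\mathbb D$ has colax (respectively strong) coproducts if $\Delta\colon\mathbb D\to\mathbb{F}\mathsf{am}(\mathbb D)$ has a left adjoint $\Sigma$ that is a colax (respectively pseudo) double functor, where the adjunction is taken in the 2-category of double categories, colax double functors and natural transformations. Colax and strong finite coproducts are defined in the same way using $\mathbb{F}\mathsf{in}\mathbb{F}\mathsf{am}(\mathbb D)$. A category with pullbacks is infinitary (respectively finitary) extensive if it has small (respectively finite) coproducts and these are disjoint and stable under pullback, equivalently, if they are van Kampen colimits. **Theorem (Coproducts of spans).**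 Let $\mathcal S$ be a category with pullbacks. 1. If $\mathcal S$ has coproducts, then $\mathbb{S}\mathsf{pan}(\mathcal S)$ has colax coproducts. If $\mathcal S$ has finite coproducts, then $\mathbb{S}\mathsf{pan}(\mathcal S)$ has colax finite coproducts. 2. If $\mathcal S$ is infinitary extensive, then $\mathbb{S}\mathsf{pan}(\mathcal S)$ has strong coproducts. If $\mathcal S$ is finitary extensive, then $\mathbb{S}\mathsf{pan}(\mathcal S)$ has strong finite coproducts. Consequently, $\mathbb{S}\mathsf{pan}$ has strong coproducts and $\mathbb{F}\mathsf{in}\mathbb{S}\mathsf{pan}$ has strong finite coproducts. -/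

import Mathlib

open CategoryTheory CategoryTheory.Limits

set_option linter.checkUnivs false

universe w p c v u p₁ c₁ v₁ u₁ p₂ c₂ v₂ u₂ p₃ c₃ v₃ u₃

namespace Dbl

/-! ## Pseudo double categories -/

/-- The data of a (pseudo) double category: objects and arrows form a category, and there are
proarrows between objects and cells between proarrows.  A cell `α : Cell m n` from a proarrow
`m : x ⇸ y` to a proarrow `n : x' ⇸ y'` has a left boundary arrow `src α : x ⟶ x'` and a right
boundary arrow `tgt α : y ⟶ y'`.  External composition `proComp` is in diagrammatic order. -/
class DoubleCategoryStruct (D : Type u) extends Category.{v} D where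
  Pro : D → D → Type p
  Cell : ∀ {x y x' y' : D}, Pro x y → Pro x' y' → Type c
  src : ∀ {x y x' y' : D} {m : Pro x y} {n : Pro x' y'}, Cell m n → (x ⟶ x')
  tgt : ∀ {x y x' y' : D} {m : Pro x y} {n : Pro x' y'}, Cell m n → (y ⟶ y')
  /-- the identity cell of a proarrow, for the composition of cells along proarrows -/
  cellId : ∀ {x y : D} (m : Pro x y), Cell m m
  /-- the composition of cells along proarrows, i.e. the composition of the category of
  proarrows and cells -/
  cellComp : ∀ {x y x' y' x'' y'' : D} {m : Pro x y} {n : Pro x' y'} {k : Pro x'' y''},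
    Cell m n → Cell n k → Cell m k
  /-- the external identity of an object -/
  proUnit : ∀ x : D, Pro x x
  /-- the external identity of an arrow -/
  unitCell : ∀ {x y : D}, (x ⟶ y) → Cell (proUnit x) (proUnit y)
  /-- the external composite of proarrows -/
  proComp : ∀ {x y z : D}, Pro x y → Pro y z → Pro x z
  /-- the external composite of cells -/
  hcomp : ∀ {x y z x' y' z' : D} {m : Pro x y} {n : Pro y z} {m' : Pro x' y'} {n' : Pro y' z'}
    (α : Cell m m') (β : Cell n n'), tgt α = src β → Cell (proComp m n) (proComp m' n')
  associator : ∀ {x y z t : D} (m : Pro x y) (n : Pro y z) (k : Pro z t),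
    Cell (proComp (proComp m n) k) (proComp m (proComp n k))
  leftUnitor : ∀ {x y : D} (m : Pro x y), Cell (proComp (proUnit x) m) m
  rightUnitor : ∀ {x y : D} (m : Pro x y), Cell (proComp m (proUnit y)) m

open DoubleCategoryStruct

local infixr:80 " ⊙ " => DoubleCategoryStruct.proComp
local infixr:70 " ⋄ " => DoubleCategoryStruct.cellComp

/-- A cell is invertible if it is an isomorphism in the category of proarrows and cells. -/
def IsInvertible {D : Type u} [DoubleCategoryStruct.{p, c, v} D] {x y x' y' : D}
    {m : Pro x y} {n : Pro x' y'} (α : Cell m n) : Prop :=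
  ∃ β : Cell n m, α ⋄ β = cellId m ∧ β ⋄ α = cellId n

/-- The laws of a pseudo double category. -/
class DoubleCategoryLaws (D : Type u) [DoubleCategoryStruct.{p, c, v} D] : Prop where
  -- proarrows and cells form a category
  id_cellComp : ∀ {x y x' y' : D} {m : Pro x y} {n : Pro x' y'} (α : Cell m n),
    cellId m ⋄ α = α
  cellComp_id : ∀ {x y x' y' : D} {m : Pro x y} {n : Pro x' y'} (α : Cell m n),
    α ⋄ cellId n = α
  cellComp_assoc : ∀ {x y x' y' x'' y'' x''' y''' : D} {m : Pro x y} {n : Pro x' y'}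
    {k : Pro x'' y''} {l : Pro x''' y'''} (α : Cell m n) (β : Cell n k) (γ : Cell k l),
    (α ⋄ β) ⋄ γ = α ⋄ (β ⋄ γ)
  -- source and target are functors
  src_id : ∀ {x y : D} (m : Pro x y), src (cellId m) = 𝟙 x
  tgt_id : ∀ {x y : D} (m : Pro x y), tgt (cellId m) = 𝟙 y
  src_comp : ∀ {x y x' y' x'' y'' : D} {m : Pro x y} {n : Pro x' y'} {k : Pro x'' y''}
    (α : Cell m n) (β : Cell n k), src (α ⋄ β) = src α ≫ src β
  tgt_comp : ∀ {x y x' y' x'' y'' : D} {m : Pro x y} {n : Pro x' y'} {k : Pro x'' y''}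
    (α : Cell m n) (β : Cell n k), tgt (α ⋄ β) = tgt α ≫ tgt β
  -- the external identity is a functor, and a section of source and target
  src_unitCell : ∀ {x y : D} (f : x ⟶ y), src (unitCell f) = f
  tgt_unitCell : ∀ {x y : D} (f : x ⟶ y), tgt (unitCell f) = f
  unitCell_id : ∀ x : D, unitCell (𝟙 x) = cellId (proUnit x)
  unitCell_comp : ∀ {x y z : D} (f : x ⟶ y) (g : y ⟶ z),
    unitCell (f ≫ g) = unitCell f ⋄ unitCell g
  -- the external composition is a functor, compatible with source and target
  src_hcomp : ∀ {x y z x' y' z' : D} {m : Pro x y} {n : Pro y z} {m' : Pro x' y'}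
    {n' : Pro y' z'} (α : Cell m m') (β : Cell n n') (h : tgt α = src β),
    src (hcomp α β h) = src α
  tgt_hcomp : ∀ {x y z x' y' z' : D} {m : Pro x y} {n : Pro y z} {m' : Pro x' y'}
    {n' : Pro y' z'} (α : Cell m m') (β : Cell n n') (h : tgt α = src β),
    tgt (hcomp α β h) = tgt β
  hcomp_id : ∀ {x y z : D} (m : Pro x y) (n : Pro y z),
    hcomp (cellId m) (cellId n) (by rw [tgt_id, src_id]) = cellId (m ⊙ n)
  hcomp_comp : ∀ {x y z x' y' z' x'' y'' z'' : D} {m : Pro x y} {n : Pro y z} {m' : Pro x' y'}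
    {n' : Pro y' z'} {m'' : Pro x'' y''} {n'' : Pro y'' z''}
    (α : Cell m m') (β : Cell n n') (γ : Cell m' m'') (δ : Cell n' n'')
    (h : tgt α = src β) (h' : tgt γ = src δ),
    hcomp (α ⋄ γ) (β ⋄ δ) (by rw [tgt_comp, src_comp, h, h']) = hcomp α β h ⋄ hcomp γ δ h'
  -- associators and unitors are globular, invertible and natural
  src_associator : ∀ {x y z t : D} (m : Pro x y) (n : Pro y z) (k : Pro z t),
    src (associator m n k) = 𝟙 x
  tgt_associator : ∀ {x y z t : D} (m : Pro x y) (n : Pro y z) (k : Pro z t),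
    tgt (associator m n k) = 𝟙 t
  src_leftUnitor : ∀ {x y : D} (m : Pro x y), src (leftUnitor m) = 𝟙 x
  tgt_leftUnitor : ∀ {x y : D} (m : Pro x y), tgt (leftUnitor m) = 𝟙 y
  src_rightUnitor : ∀ {x y : D} (m : Pro x y), src (rightUnitor m) = 𝟙 x
  tgt_rightUnitor : ∀ {x y : D} (m : Pro x y), tgt (rightUnitor m) = 𝟙 y
  isInvertible_associator : ∀ {x y z t : D} (m : Pro x y) (n : Pro y z) (k : Pro z t),
    IsInvertible (associator m n k)
  isInvertible_leftUnitor : ∀ {x y : D} (m : Pro x y), IsInvertible (leftUnitor m)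
  isInvertible_rightUnitor : ∀ {x y : D} (m : Pro x y), IsInvertible (rightUnitor m)
  associator_naturality : ∀ {x y z t x' y' z' t' : D} {m : Pro x y} {n : Pro y z} {k : Pro z t}
    {m' : Pro x' y'} {n' : Pro y' z'} {k' : Pro z' t'}
    (α : Cell m m') (β : Cell n n') (γ : Cell k k') (h : tgt α = src β) (h' : tgt β = src γ),
    hcomp (hcomp α β h) γ (by rw [tgt_hcomp, h']) ⋄ associator m' n' k' =
      associator m n k ⋄ hcomp α (hcomp β γ h') (by rw [src_hcomp, h])
  leftUnitor_naturality : ∀ {x y x' y' : D} {m : Pro x y} {m' : Pro x' y'} (α : Cell m m'),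
    hcomp (unitCell (src α)) α (tgt_unitCell _) ⋄ leftUnitor m' = leftUnitor m ⋄ α
  rightUnitor_naturality : ∀ {x y x' y' : D} {m : Pro x y} {m' : Pro x' y'} (α : Cell m m'),
    hcomp α (unitCell (tgt α)) (src_unitCell _).symm ⋄ rightUnitor m' = rightUnitor m ⋄ α
  -- coherence
  pentagon : ∀ {x y z t s : D} (m : Pro x y) (n : Pro y z) (k : Pro z t) (l : Pro t s),
    hcomp (associator m n k) (cellId l) (by rw [tgt_associator, src_id]) ⋄ associator m (n ⊙ k) l ⋄
        hcomp (cellId m) (associator n k l) (by rw [tgt_id, src_associator]) =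
      associator (m ⊙ n) k l ⋄ associator m n (k ⊙ l)
  triangle : ∀ {x y z : D} (m : Pro x y) (n : Pro y z),
    associator m (proUnit y) n ⋄ hcomp (cellId m) (leftUnitor n) (by rw [tgt_id, src_leftUnitor]) =
      hcomp (rightUnitor m) (cellId n) (by rw [tgt_rightUnitor, src_id])

/-- A pseudo double category. -/
class DoubleCategory (D : Type u) extends DoubleCategoryStruct.{p, c, v} D, DoubleCategoryLaws D

open DoubleCategoryLaws

attribute [simp] id_cellComp cellComp_id cellComp_assoc src_id tgt_id src_comp tgt_comp
  src_unitCell tgt_unitCell src_hcomp tgt_hcomp src_associator tgt_associator src_leftUnitor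
  tgt_leftUnitor src_rightUnitor tgt_rightUnitor

/-! ## Colax double functors, natural transformations, adjunctions -/

/-- A colax double functor between pseudo double categories. -/
structure ColaxFunctor (C : Type u₁) [DoubleCategory.{p₁, c₁, v₁} C]
    (D : Type u₂) [DoubleCategory.{p₂, c₂, v₂} D] extends C ⥤ D where
  mapPro : ∀ {x y : C}, Pro x y → Pro (obj x) (obj y)
  mapCell : ∀ {x y x' y' : C} {m : Pro x y} {n : Pro x' y'},
    Cell m n → Cell (mapPro m) (mapPro n)
  src_mapCell : ∀ {x y x' y' : C} {m : Pro x y} {n : Pro x' y'} (α : Cell m n),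
    src (mapCell α) = map (src α)
  tgt_mapCell : ∀ {x y x' y' : C} {m : Pro x y} {n : Pro x' y'} (α : Cell m n),
    tgt (mapCell α) = map (tgt α)
  mapCell_id : ∀ {x y : C} (m : Pro x y), mapCell (cellId m) = cellId (mapPro m)
  mapCell_comp : ∀ {x y x' y' x'' y'' : C} {m : Pro x y} {n : Pro x' y'} {k : Pro x'' y''}
    (α : Cell m n) (β : Cell n k), mapCell (α ⋄ β) = mapCell α ⋄ mapCell β
  /-- the composition comparison cell -/
  compCell : ∀ {x y z : C} (m : Pro x y) (n : Pro y z),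
    Cell (mapPro (m ⊙ n)) (mapPro m ⊙ mapPro n)
  /-- the identity comparison cell -/
  idCell : ∀ x : C, Cell (mapPro (proUnit x)) (proUnit (obj x))
  src_compCell : ∀ {x y z : C} (m : Pro x y) (n : Pro y z), src (compCell m n) = 𝟙 (obj x)
  tgt_compCell : ∀ {x y z : C} (m : Pro x y) (n : Pro y z), tgt (compCell m n) = 𝟙 (obj z)
  src_idCell : ∀ x : C, src (idCell x) = 𝟙 (obj x)
  tgt_idCell : ∀ x : C, tgt (idCell x) = 𝟙 (obj x)
  compCell_naturality : ∀ {x y z x' y' z' : C} {m : Pro x y} {n : Pro y z} {m' : Pro x' y'}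
    {n' : Pro y' z'} (α : Cell m m') (β : Cell n n') (h : tgt α = src β),
    mapCell (hcomp α β h) ⋄ compCell m' n' =
      compCell m n ⋄ hcomp (mapCell α) (mapCell β) (by rw [tgt_mapCell, src_mapCell, h])
  idCell_naturality : ∀ {x y : C} (f : x ⟶ y),
    mapCell (unitCell f) ⋄ idCell y = idCell x ⋄ unitCell (map f)
  coassociativity : ∀ {x y z t : C} (m : Pro x y) (n : Pro y z) (k : Pro z t),
    mapCell (associator m n k) ⋄ compCell m (n ⊙ k) ⋄
        hcomp (cellId (mapPro m)) (compCell n k) (by rw [tgt_id, src_compCell]) =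
      compCell (m ⊙ n) k ⋄
        hcomp (compCell m n) (cellId (mapPro k)) (by rw [tgt_compCell, src_id]) ⋄
          associator (mapPro m) (mapPro n) (mapPro k)
  left_counitality : ∀ {x y : C} (m : Pro x y),
    mapCell (leftUnitor m) = compCell (proUnit x) m ⋄
      hcomp (idCell x) (cellId (mapPro m)) (by rw [tgt_idCell, src_id]) ⋄
        leftUnitor (mapPro m)
  right_counitality : ∀ {x y : C} (m : Pro x y),
    mapCell (rightUnitor m) = compCell m (proUnit y) ⋄
      hcomp (cellId (mapPro m)) (idCell y) (by rw [src_idCell, tgt_id]) ⋄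
        rightUnitor (mapPro m)

namespace ColaxFunctor

attribute [simp] src_mapCell tgt_mapCell mapCell_id mapCell_comp src_compCell tgt_compCell
  src_idCell tgt_idCell

/-- A colax double functor is a pseudo double functor if its comparison cells are invertible. -/
def IsPseudo {C : Type u₁} [DoubleCategory.{p₁, c₁, v₁} C]
    {D : Type u₂} [DoubleCategory.{p₂, c₂, v₂} D] (F : ColaxFunctor C D) : Prop :=
  (∀ {x y z : C} (m : Pro x y) (n : Pro y z), IsInvertible (F.compCell m n)) ∧
    ∀ x : C, IsInvertible (F.idCell x)

section

variable {C : Type u₁} [DoubleCategory.{p₁, c₁, v₁} C] {D : Type u₂} [DoubleCategory.{p₂, c₂, v₂} D]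
  {E : Type u₃} [DoubleCategory.{p₃, c₃, v₃} E]

/-- The identity double functor. -/
def id (C : Type u₁) [DoubleCategory.{p₁, c₁, v₁} C] : ColaxFunctor C C where
  toFunctor := 𝟭 C
  mapPro m := m
  mapCell α := α
  src_mapCell _ := rfl
  tgt_mapCell _ := rfl
  mapCell_id _ := rfl
  mapCell_comp _ _ := rfl
  compCell m n := cellId (m ⊙ n)
  idCell x := cellId (proUnit x)
  src_compCell _ _ := src_id _
  tgt_compCell _ _ := tgt_id _
  src_idCell _ := src_id _
  tgt_idCell _ := tgt_id _
  compCell_naturality α β h := by simp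
  idCell_naturality f := by simp
  coassociativity m n k := by simp [hcomp_id]
  left_counitality m := by simp [hcomp_id]
  right_counitality m := by simp [hcomp_id]

theorem hcomp_id_comp {x y z z' z'' : D} {m : Pro x y} {n : Pro y z} {n' : Pro y z'}
    {n'' : Pro y z''} (β : Cell n n') (γ : Cell n' n'') (h : src β = 𝟙 _) (h' : src γ = 𝟙 _) :
    hcomp (cellId m) (β ⋄ γ) (by simp [h, h']) =
      hcomp (cellId m) β (by simp [h]) ⋄ hcomp (cellId m) γ (by simp [h']) := by
  rw [← hcomp_comp]; simp

theorem hcomp_comp_id {x y z x' x'' : D} {m : Pro x y} {m' : Pro x' y} {m'' : Pro x'' y}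
    {n : Pro y z} (β : Cell m m') (γ : Cell m' m'') (h : tgt β = 𝟙 _) (h' : tgt γ = 𝟙 _) :
    hcomp (β ⋄ γ) (cellId n) (by simp [h, h']) =
      hcomp β (cellId n) (by simp [h]) ⋄ hcomp γ (cellId n) (by simp [h']) := by
  rw [← hcomp_comp]; simp

/-- The composite of colax double functors, in diagrammatic order. -/
def comp (F : ColaxFunctor C D) (G : ColaxFunctor D E) : ColaxFunctor C E where
  toFunctor := F.toFunctor ⋙ G.toFunctor
  mapPro m := G.mapPro (F.mapPro m)
  mapCell α := G.mapCell (F.mapCell α)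
  src_mapCell _ := by simp
  tgt_mapCell _ := by simp
  mapCell_id _ := by simp
  mapCell_comp _ _ := by simp
  compCell m n := G.mapCell (F.compCell m n) ⋄ G.compCell (F.mapPro m) (F.mapPro n)
  idCell x := G.mapCell (F.idCell x) ⋄ G.idCell (F.obj x)
  src_compCell _ _ := by simp
  tgt_compCell _ _ := by simp
  src_idCell _ := by simp
  tgt_idCell _ := by simp
  compCell_naturality α β h := by
    rw [← cellComp_assoc, ← G.mapCell_comp, F.compCell_naturality, G.mapCell_comp, cellComp_assoc,
      G.compCell_naturality, cellComp_assoc]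
  idCell_naturality f := by
    rw [← cellComp_assoc, ← G.mapCell_comp, F.idCell_naturality, G.mapCell_comp, cellComp_assoc,
      G.idCell_naturality, cellComp_assoc]
    rfl
  coassociativity m n k := by
    have h1 := congrArg G.mapCell (F.coassociativity m n k)
    have h2 := G.coassociativity (F.mapPro m) (F.mapPro n) (F.mapPro k)
    have h3 := G.compCell_naturality (cellId (F.mapPro m)) (F.compCell n k) (by simp)
    have h4 := G.compCell_naturality (F.compCell m n) (cellId (F.mapPro k)) (by simp)
    simp only [mapCell_comp, mapCell_id] at h1 h3 h4
    rw [hcomp_id_comp _ _ (by simp) (by simp), hcomp_comp_id _ _ (by simp) (by simp)]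
    simp only [cellComp_assoc]
    rw [← cellComp_assoc (G.compCell (F.mapPro m) _), ← h3, cellComp_assoc,
      ← cellComp_assoc (G.compCell (F.mapPro (m ⊙ n)) _), ← h4, cellComp_assoc, ← h2]
    simp only [← cellComp_assoc] at h1 ⊢
    rw [h1]
  left_counitality m := by
    have h1 := congrArg G.mapCell (F.left_counitality m)
    have h2 := G.left_counitality (F.mapPro m)
    have h4 := G.compCell_naturality (F.idCell _) (cellId (F.mapPro m)) (by simp)
    simp only [mapCell_comp, mapCell_id] at h1 h4
    rw [h1, h2, hcomp_comp_id _ _ (by simp) (by simp)]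
    simp only [cellComp_assoc]
    rw [← cellComp_assoc (G.compCell (F.mapPro _) (F.mapPro _)), ← h4, cellComp_assoc]
  right_counitality m := by
    have h1 := congrArg G.mapCell (F.right_counitality m)
    have h2 := G.right_counitality (F.mapPro m)
    have h4 := G.compCell_naturality (cellId (F.mapPro m)) (F.idCell _) (by simp)
    simp only [mapCell_comp, mapCell_id] at h1 h4
    rw [h1, h2, hcomp_id_comp _ _ (by simp) (by simp)]
    simp only [cellComp_assoc]
    rw [← cellComp_assoc (G.compCell (F.mapPro _) (F.mapPro _)), ← h4, cellComp_assoc]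

/-- A natural transformation between colax double functors. -/
structure NatTrans (F G : ColaxFunctor C D) extends CategoryTheory.NatTrans F.toFunctor G.toFunctor
    where
  /-- the component at a proarrow -/
  cell : ∀ {x y : C} (m : Pro x y), Cell (F.mapPro m) (G.mapPro m)
  src_cell : ∀ {x y : C} (m : Pro x y), src (cell m) = app x
  tgt_cell : ∀ {x y : C} (m : Pro x y), tgt (cell m) = app y
  cell_naturality : ∀ {x y x' y' : C} {m : Pro x y} {n : Pro x' y'} (α : Cell m n),
    F.mapCell α ⋄ cell n = cell m ⋄ G.mapCell α
  cell_comp : ∀ {x y z : C} (m : Pro x y) (n : Pro y z),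
    cell (m ⊙ n) ⋄ G.compCell m n =
      F.compCell m n ⋄ hcomp (cell m) (cell n) (by rw [tgt_cell, src_cell])
  cell_unit : ∀ x : C, cell (proUnit x) ⋄ G.idCell x = F.idCell x ⋄ unitCell (app x)

/-- A double adjunction `F ⊣ G`: an adjunction in the 2-category of double categories, colax double
functors and natural transformations. -/
structure Adjunction (F : ColaxFunctor C D) (G : ColaxFunctor D C) where
  unit : NatTrans (id C) (F.comp G)
  counit : NatTrans (G.comp F) (id D)
  left_triangle : ∀ x : C, F.map (unit.app x) ≫ counit.app (F.obj x) = 𝟙 (F.obj x)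
  right_triangle : ∀ y : D, unit.app (G.obj y) ≫ G.map (counit.app y) = 𝟙 (G.obj y)
  left_triangle_cell : ∀ {x y : C} (m : Pro x y),
    F.mapCell (unit.cell m) ⋄ counit.cell (F.mapPro m) = cellId (F.mapPro m)
  right_triangle_cell : ∀ {x y : D} (m : Pro x y),
    unit.cell (G.mapPro m) ⋄ G.mapCell (counit.cell m) = cellId (G.mapPro m)

end

end ColaxFunctor

/-! ## The double category of spans -/

section Spans

variable {S : Type u} [Category.{v} S]

/-- A span from `x` to `y` in `S`. -/
structure SpanPro (x y : S) where
  apex : S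
  l : apex ⟶ x
  r : apex ⟶ y

/-- A map of spans, with possibly nonidentity maps between the feet. -/
@[ext]
structure SpanCell {x y x' y' : S} (m : SpanPro x y) (n : SpanPro x' y') where
  src : x ⟶ x'
  tgt : y ⟶ y'
  hom : m.apex ⟶ n.apex
  hom_l : hom ≫ n.l = m.l ≫ src
  hom_r : hom ≫ n.r = m.r ≫ tgt

theorem SpanCell.hom_l_assoc {x y x' y' : S} {m : SpanPro x y} {n : SpanPro x' y'}
    (α : SpanCell m n) {t : S} (f : x' ⟶ t) : α.hom ≫ n.l ≫ f = m.l ≫ α.src ≫ f := by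
  rw [← Category.assoc, α.hom_l, Category.assoc]

theorem SpanCell.hom_r_assoc {x y x' y' : S} {m : SpanPro x y} {n : SpanPro x' y'}
    (α : SpanCell m n) {t : S} (f : y' ⟶ t) : α.hom ≫ n.r ≫ f = m.r ≫ α.tgt ≫ f := by
  rw [← Category.assoc, α.hom_r, Category.assoc]

attribute [simp] SpanCell.hom_l SpanCell.hom_r SpanCell.hom_l_assoc SpanCell.hom_r_assoc

namespace SpanPro

/-- The identity span. -/
def id (x : S) : SpanPro x x := ⟨x, 𝟙 x, 𝟙 x⟩

@[simp] theorem id_r (x : S) : (id x).r = (id x).l := rfl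

/-- The identity morphism of `x`, as a morphism into the apex of the identity span. -/
def toId (x : S) : x ⟶ (id x).apex := 𝟙 x

@[simp] theorem toId_l (x : S) : toId x ≫ (id x).l = 𝟙 x := Category.comp_id (𝟙 x)

@[simp] theorem l_toId (x : S) : (id x).l ≫ toId x = 𝟙 _ := Category.comp_id (𝟙 x)

end SpanPro

namespace SpanCell

@[simps] def id {x y : S} (m : SpanPro x y) : SpanCell m m :=
  ⟨𝟙 x, 𝟙 y, 𝟙 m.apex, by simp, by simp⟩

@[simps] def comp {x y x' y' x'' y'' : S} {m : SpanPro x y} {n : SpanPro x' y'}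
    {k : SpanPro x'' y''} (α : SpanCell m n) (β : SpanCell n k) : SpanCell m k :=
  ⟨α.src ≫ β.src, α.tgt ≫ β.tgt, α.hom ≫ β.hom, by simp, by simp⟩

/-- The map of identity spans given by `f` on the feet and on the apex. -/
@[simps] def unit {x y : S} (f : x ⟶ y) : SpanCell (SpanPro.id x) (SpanPro.id y) :=
  ⟨f, f, (SpanPro.id x).l ≫ f ≫ SpanPro.toId y, by simp, by simp⟩

theorem unit_id (x : S) : unit (𝟙 x) = id (SpanPro.id x) := by
  ext <;> simp

theorem toId_l_assoc {x t : S} (f : x ⟶ t) : SpanPro.toId x ≫ (SpanPro.id x).l ≫ f = f := by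
  rw [← Category.assoc, SpanPro.toId_l, Category.id_comp]

theorem unit_comp {x y z : S} (f : x ⟶ y) (g : y ⟶ z) :
    unit (f ≫ g) = (unit f).comp (unit g) := by
  ext <;> simp [toId_l_assoc]

theorem isInvertible {x y : S} {m n : SpanPro x y} (α : SpanCell m n) (h : α.src = 𝟙 x)
    (h' : α.tgt = 𝟙 y) (g : n.apex ⟶ m.apex) (hg : α.hom ≫ g = 𝟙 _) (hg' : g ≫ α.hom = 𝟙 _) :
    ∃ β : SpanCell n m, α.comp β = id m ∧ β.comp α = id n := by
  have hl : α.hom ≫ n.l = m.l := by simp [h]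
  have hr : α.hom ≫ n.r = m.r := by simp [h']
  refine ⟨⟨𝟙 x, 𝟙 y, g, ?_, ?_⟩, ?_, ?_⟩
  · rw [← hl, ← Category.assoc, hg', Category.id_comp, Category.comp_id]
  · rw [← hr, ← Category.assoc, hg', Category.id_comp, Category.comp_id]
  · ext <;> simp [h, h', hg]
  · ext <;> simp [h, h', hg']

end SpanCell

variable [HasPullbacks S]

namespace SpanPro

variable {x y z : S} (m : SpanPro x y) (n : SpanPro y z)

/-- Composition of spans by pullback. -/
noncomputable def comp : SpanPro x z where
  apex := pullback m.r n.l
  l := pullback.fst m.r n.l ≫ m.l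
  r := pullback.snd m.r n.l ≫ n.r

noncomputable def fst : (m.comp n).apex ⟶ m.apex := pullback.fst m.r n.l

noncomputable def snd : (m.comp n).apex ⟶ n.apex := pullback.snd m.r n.l

theorem comp_l : (m.comp n).l = m.fst n ≫ m.l := rfl

theorem comp_r : (m.comp n).r = m.snd n ≫ n.r := rfl

theorem condition : m.fst n ≫ m.r = m.snd n ≫ n.l := pullback.condition

theorem condition_assoc {t : S} (f : y ⟶ t) : m.fst n ≫ m.r ≫ f = m.snd n ≫ n.l ≫ f :=
  pullback.condition_assoc f

variable {m n}

noncomputable def lift {t : S} (a : t ⟶ m.apex) (b : t ⟶ n.apex) (h : a ≫ m.r = b ≫ n.l) :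
    t ⟶ (m.comp n).apex := pullback.lift a b h

theorem lift_fst {t : S} (a : t ⟶ m.apex) (b : t ⟶ n.apex) (h : a ≫ m.r = b ≫ n.l) :
    lift a b h ≫ m.fst n = a := pullback.lift_fst a b h

theorem lift_snd {t : S} (a : t ⟶ m.apex) (b : t ⟶ n.apex) (h : a ≫ m.r = b ≫ n.l) :
    lift a b h ≫ m.snd n = b := pullback.lift_snd a b h

theorem lift_fst_assoc {t s : S} (a : t ⟶ m.apex) (b : t ⟶ n.apex) (h : a ≫ m.r = b ≫ n.l)
    (f : m.apex ⟶ s) : lift a b h ≫ m.fst n ≫ f = a ≫ f := by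
  rw [← Category.assoc, lift_fst]

theorem lift_snd_assoc {t s : S} (a : t ⟶ m.apex) (b : t ⟶ n.apex) (h : a ≫ m.r = b ≫ n.l)
    (f : n.apex ⟶ s) : lift a b h ≫ m.snd n ≫ f = b ≫ f := by
  rw [← Category.assoc, lift_snd]

theorem comp_hom_ext {t : S} {a b : t ⟶ (m.comp n).apex} (h : a ≫ m.fst n = b ≫ m.fst n)
    (h' : a ≫ m.snd n = b ≫ m.snd n) : a = b := pullback.hom_ext h h'

attribute [simp] comp_l comp_r condition condition_assoc lift_fst lift_snd lift_fst_assoc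
  lift_snd_assoc

end SpanPro

namespace SpanCell

open SpanPro

@[simps] noncomputable def hcomp {x y z x' y' z' : S} {m : SpanPro x y} {n : SpanPro y z}
    {m' : SpanPro x' y'} {n' : SpanPro y' z'} (α : SpanCell m m') (β : SpanCell n n')
    (h : α.tgt = β.src) : SpanCell (m.comp n) (m'.comp n') where
  src := α.src
  tgt := β.tgt
  hom := lift (m.fst n ≫ α.hom) (m.snd n ≫ β.hom) (by simp [h])
  hom_l := by simp
  hom_r := by simp

@[simps] noncomputable def associator {x y z t : S} (m : SpanPro x y) (n : SpanPro y z)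
    (k : SpanPro z t) : SpanCell ((m.comp n).comp k) (m.comp (n.comp k)) where
  src := 𝟙 x
  tgt := 𝟙 t
  hom := lift ((m.comp n).fst k ≫ m.fst n)
    (lift ((m.comp n).fst k ≫ m.snd n) ((m.comp n).snd k)
      (by simpa using (m.comp n).condition k)) (by simp)
  hom_l := by simp
  hom_r := by simp

@[simps] noncomputable def leftUnitor {x y : S} (m : SpanPro x y) :
    SpanCell ((SpanPro.id x).comp m) m :=
  ⟨𝟙 x, 𝟙 y, (SpanPro.id x).snd m, by simp [← SpanPro.condition], by simp⟩

@[simps] noncomputable def rightUnitor {x y : S} (m : SpanPro x y) :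
    SpanCell (m.comp (SpanPro.id y)) m :=
  ⟨𝟙 x, 𝟙 y, m.fst (SpanPro.id y), by simp, by simp⟩

end SpanCell

/-- The objects of the double category of spans in `S` are the objects of `S`. -/
structure SpanCat (S : Type u) where
  obj : S

instance (S : Type u) [Category.{v} S] : Category.{v} (SpanCat S) where
  Hom x y := x.obj ⟶ y.obj
  id x := 𝟙 x.obj
  comp f g := f ≫ g
  id_comp := Category.id_comp (obj := S)
  comp_id := Category.comp_id (obj := S)
  assoc := Category.assoc (obj := S)

/-- The double category of spans in `S`: arrows are morphisms of `S`, proarrows are spans in `S`,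
cells are maps of spans. -/
noncomputable instance SpanCat.struct : DoubleCategoryStruct.{max u v, v, v} (SpanCat S) where
  Pro x y := SpanPro x.obj y.obj
  Cell m n := SpanCell m n
  src α := α.src
  tgt α := α.tgt
  cellId m := SpanCell.id m
  cellComp α β := α.comp β
  proUnit x := SpanPro.id x.obj
  unitCell f := SpanCell.unit f
  proComp m n := m.comp n
  hcomp α β h := α.hcomp β h
  associator m n k := SpanCell.associator m n k
  leftUnitor m := SpanCell.leftUnitor m
  rightUnitor m := SpanCell.rightUnitor m

namespace SpanCell

open SpanPro

theorem hcomp_id {x y z : S} (m : SpanPro x y) (n : SpanPro y z) :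
    hcomp (id m) (id n) (by simp) = id (m.comp n) := by
  ext
  · simp
  · simp
  · apply comp_hom_ext <;> simp

theorem hcomp_comp {x y z x' y' z' x'' y'' z'' : S} {m : SpanPro x y} {n : SpanPro y z}
    {m' : SpanPro x' y'} {n' : SpanPro y' z'} {m'' : SpanPro x'' y''} {n'' : SpanPro y'' z''}
    (α : SpanCell m m') (β : SpanCell n n') (γ : SpanCell m' m'') (δ : SpanCell n' n'')
    (h : α.tgt = β.src) (h' : γ.tgt = δ.src) :
    hcomp (α.comp γ) (β.comp δ) (by simp [h, h']) = (hcomp α β h).comp (hcomp γ δ h') := by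
  ext
  · simp
  · simp
  · apply comp_hom_ext <;> simp

theorem associator_naturality {x y z t x' y' z' t' : S} {m : SpanPro x y} {n : SpanPro y z}
    {k : SpanPro z t} {m' : SpanPro x' y'} {n' : SpanPro y' z'} {k' : SpanPro z' t'}
    (α : SpanCell m m') (β : SpanCell n n') (γ : SpanCell k k') (h : α.tgt = β.src)
    (h' : β.tgt = γ.src) :
    (hcomp (hcomp α β h) γ (by simpa)).comp (associator m' n' k') =
      (associator m n k).comp (hcomp α (hcomp β γ h') (by simpa)) := by
  ext
  · simp
  · simp
  · apply comp_hom_ext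
    · simp
    · apply comp_hom_ext <;> simp

theorem leftUnitor_naturality {x y x' y' : S} {m : SpanPro x y} {m' : SpanPro x' y'}
    (α : SpanCell m m') :
    (hcomp (unit α.src) α (by simp)).comp (leftUnitor m') = (leftUnitor m).comp α := by
  ext <;> simp

theorem rightUnitor_naturality {x y x' y' : S} {m : SpanPro x y} {m' : SpanPro x' y'}
    (α : SpanCell m m') :
    (hcomp α (unit α.tgt) (by simp)).comp (rightUnitor m') = (rightUnitor m).comp α := by
  ext <;> simp

theorem pentagon {x y z t s : S} (m : SpanPro x y) (n : SpanPro y z) (k : SpanPro z t)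
    (l : SpanPro t s) :
    (hcomp (associator m n k) (id l) (by simp)).comp ((associator m (n.comp k) l).comp
        (hcomp (id m) (associator n k l) (by simp))) =
      (associator (m.comp n) k l).comp (associator m n (k.comp l)) := by
  ext
  · simp
  · simp
  · apply comp_hom_ext
    · simp
    · apply comp_hom_ext
      · simp
      · apply comp_hom_ext <;> simp

theorem triangle {x y z : S} (m : SpanPro x y) (n : SpanPro y z) :
    (associator m (SpanPro.id y) n).comp (hcomp (id m) (leftUnitor n) (by simp)) =
      hcomp (rightUnitor m) (id n) (by simp) := by
  ext
  · simp
  · simp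
  · apply comp_hom_ext <;> simp

theorem isInvertible_associator {x y z t : S} (m : SpanPro x y) (n : SpanPro y z)
    (k : SpanPro z t) :
    ∃ β, (associator m n k).comp β = id _ ∧ β.comp (associator m n k) = id _ := by
  refine isInvertible _ rfl rfl
    (lift (lift (m.fst (n.comp k)) (m.snd (n.comp k) ≫ n.fst k)
      (by simp)) (m.snd (n.comp k) ≫ n.snd k) (by simp)) ?_ ?_
  · apply comp_hom_ext
    · apply comp_hom_ext <;> simp
    · simp
  · apply comp_hom_ext
    · simp
    · apply comp_hom_ext <;> simp

theorem isInvertible_leftUnitor {x y : S} (m : SpanPro x y) :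
    ∃ β, (leftUnitor m).comp β = id _ ∧ β.comp (leftUnitor m) = id _ := by
  refine isInvertible _ rfl rfl (lift (m.l ≫ toId x) (𝟙 _) (by simp)) ?_ ?_
  · apply comp_hom_ext
    · have := (SpanPro.id x).condition_assoc m (toId x)
      simp only [id_r, l_toId, Category.comp_id] at this
      simp [this]
    · simp
  · simp

theorem isInvertible_rightUnitor {x y : S} (m : SpanPro x y) :
    ∃ β, (rightUnitor m).comp β = id _ ∧ β.comp (rightUnitor m) = id _ := by
  refine isInvertible _ rfl rfl (lift (𝟙 _) (m.r ≫ toId y) (by simp)) ?_ ?_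
  · apply comp_hom_ext <;> simp
  · simp

end SpanCell

noncomputable instance : DoubleCategory.{max u v, v, v} (SpanCat S) where
  id_cellComp _ := SpanCell.ext (Category.id_comp _) (Category.id_comp _) (Category.id_comp _)
  cellComp_id _ := SpanCell.ext (Category.comp_id _) (Category.comp_id _) (Category.comp_id _)
  cellComp_assoc _ _ _ :=
    SpanCell.ext (Category.assoc _ _ _) (Category.assoc _ _ _) (Category.assoc _ _ _)
  src_id _ := rfl
  tgt_id _ := rfl
  src_comp _ _ := rfl
  tgt_comp _ _ := rfl
  src_unitCell _ := rfl
  tgt_unitCell _ := rfl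
  unitCell_id x := SpanCell.unit_id x.obj
  unitCell_comp f g := SpanCell.unit_comp (S := S) f g
  src_hcomp _ _ _ := rfl
  tgt_hcomp _ _ _ := rfl
  hcomp_id m n := SpanCell.hcomp_id (S := S) m n
  hcomp_comp α β γ δ h h' := SpanCell.hcomp_comp (S := S) α β γ δ h h'
  src_associator _ _ _ := rfl
  tgt_associator _ _ _ := rfl
  src_leftUnitor _ := rfl
  tgt_leftUnitor _ := rfl
  src_rightUnitor _ := rfl
  tgt_rightUnitor _ := rfl
  isInvertible_associator m n k := SpanCell.isInvertible_associator (S := S) m n k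
  isInvertible_leftUnitor m := SpanCell.isInvertible_leftUnitor (S := S) m
  isInvertible_rightUnitor m := SpanCell.isInvertible_rightUnitor (S := S) m
  associator_naturality α β γ h h' := SpanCell.associator_naturality (S := S) α β γ h h'
  leftUnitor_naturality α := SpanCell.leftUnitor_naturality (S := S) α
  rightUnitor_naturality α := SpanCell.rightUnitor_naturality (S := S) α
  pentagon m n k l := SpanCell.pentagon (S := S) m n k l
  triangle m n := SpanCell.triangle (S := S) m n

end Spans

/-! ## The double category of families -/

/-- A class of sets that is allowed for indexing: it contains the one-point set and is closed under
pullbacks. -/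
structure IndexClass where
  mem : Type w → Prop
  punit : mem PUnit
  pullback : ∀ {A B J : Type w} (f : A → J) (g : B → J), mem A → mem B →
    mem {p : A × B // f p.1 = g p.2}

/-- All (small) sets. -/
def IndexClass.all : IndexClass.{w} := ⟨fun _ => True, trivial, fun _ _ _ _ => trivial⟩

/-- The finite sets. -/
def IndexClass.finite : IndexClass.{w} :=
  ⟨fun A => Finite A, inferInstance, fun _ _ hA hB => by
    have := hA
    have := hB
    infer_instance⟩

/-- A span of sets with apex in the class `K`. -/
structure IndexSpan (K : IndexClass.{w}) (I J : Type w) where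
  apex : Type w
  mem : K.mem apex
  l : apex → I
  r : apex → J

namespace IndexSpan

variable {K : IndexClass.{w}} {I J L I' J' : Type w}

/-- The elements `a : i ⇸ j` of a span `A : I ⇸ J`, i.e. those with `l a = i` and `r a = j`. -/
@[ext]
structure Elt (A : IndexSpan K I J) (i : I) (j : J) : Type w where
  val : A.apex
  l_val : A.l val = i
  r_val : A.r val = j

/-- The image of an element under a map of spans. -/
def Elt.map {A : IndexSpan K I J} {B : IndexSpan K I' J'} {f : I → I'} {g : J → J'}
    (h : A.apex → B.apex) (hl : ∀ a, B.l (h a) = f (A.l a)) (hr : ∀ a, B.r (h a) = g (A.r a))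
    {i : I} {j : J} (a : A.Elt i j) : B.Elt (f i) (g j) :=
  ⟨h a.val, (hl _).trans (congrArg f a.l_val), (hr _).trans (congrArg g a.r_val)⟩

/-- The identity span. -/
def id (I : Type w) (h : K.mem I) : IndexSpan K I I := ⟨I, h, fun i => i, fun i => i⟩

theorem Elt.eq_of_id {h : K.mem I} {i j : I} (a : (IndexSpan.id I h).Elt i j) : i = j :=
  a.l_val.symm.trans a.r_val

/-- Composition of spans by pullback. -/
def comp (A : IndexSpan K I J) (B : IndexSpan K J L) : IndexSpan K I L where
  apex := {p : A.apex × B.apex // A.r p.1 = B.l p.2}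
  mem := K.pullback A.r B.l A.mem B.mem
  l p := A.l p.1.1
  r p := B.r p.1.2

section

variable {A : IndexSpan K I J} {B : IndexSpan K J L} {i : I} {k : L}

/-- For an element `(a, b)` of a composite of spans, with `a : i ⇸ j` and `b : j ⇸ k`, the
element `j`. -/
def Elt.mid (p : (A.comp B).Elt i k) : J := A.r p.val.1.1

def Elt.fst (p : (A.comp B).Elt i k) : A.Elt i p.mid := ⟨p.val.1.1, p.l_val, rfl⟩

def Elt.snd (p : (A.comp B).Elt i k) : B.Elt p.mid k := ⟨p.val.1.2, p.val.2.symm, p.r_val⟩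

end

end IndexSpan

section Families

/-- A family of objects of `D`, indexed by a set in the class `K`. -/
structure Fam (K : IndexClass.{w}) (D : Type u) where
  I : Type w
  mem : K.mem I
  obj : I → D

variable {K : IndexClass.{w}} {D : Type u} [DoubleCategory.{p, c, v} D]

/-- A morphism of families of objects. -/
structure FamHom (X Y : Fam K D) where
  index : X.I → Y.I
  hom : ∀ i, X.obj i ⟶ Y.obj (index i)

instance : Category (Fam K D) where
  Hom := FamHom
  id X := ⟨fun i => i, fun i => 𝟙 (X.obj i)⟩
  comp f g := ⟨fun i => g.index (f.index i), fun i => f.hom i ≫ g.hom (f.index i)⟩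
  id_comp f := by simp
  comp_id f := by simp
  assoc f g h := by simp

/-- A family of proarrows: an indexing span `A : I ⇸ J` with a proarrow `pro a : x i ⇸ y j` for
every element `a : i ⇸ j` of the span. -/
structure FamPro (X Y : Fam K D) where
  A : IndexSpan K X.I Y.I
  pro : ∀ {i : X.I} {j : Y.I}, A.Elt i j → Pro (X.obj i) (Y.obj j)

/-- A cell between families of proarrows: a map of indexing spans and a family of cells. -/
structure FamCell {X Y X' Y' : Fam K D} (m : FamPro X Y) (n : FamPro X' Y') where
  src : X ⟶ X'
  tgt : Y ⟶ Y'
  index : m.A.apex → n.A.apex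
  l_index : ∀ a, n.A.l (index a) = src.index (m.A.l a)
  r_index : ∀ a, n.A.r (index a) = tgt.index (m.A.r a)
  cell : ∀ {i : X.I} {j : Y.I} (a : m.A.Elt i j), Cell (m.pro a) (n.pro (a.map index l_index r_index))
  src_cell : ∀ {i : X.I} {j : Y.I} (a : m.A.Elt i j), DoubleCategoryStruct.src (cell a) = src.hom i
  tgt_cell : ∀ {i : X.I} {j : Y.I} (a : m.A.Elt i j), DoubleCategoryStruct.tgt (cell a) = tgt.hom j

namespace FamPro

variable {X Y Z : Fam K D}

/-- The identity proarrow of `X.obj i`, as a proarrow to `X.obj j` when `i = j`. -/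
def idPro (X : Fam K D) : ∀ {i j : X.I}, i = j → Pro (X.obj i) (X.obj j)
  | i, _, rfl => proUnit (X.obj i)

/-- The identity family of proarrows. -/
def id (X : Fam K D) : FamPro X X where
  A := IndexSpan.id X.I X.mem
  pro a := idPro X a.eq_of_id

/-- Composition of families of proarrows: the indexing spans are composed by pullback, the proarrows
componentwise. -/
def comp (m : FamPro X Y) (n : FamPro Y Z) : FamPro X Z where
  A := m.A.comp n.A
  pro a := m.pro a.fst ⊙ n.pro a.snd

end FamPro

/-- The component of a morphism of families at `i`, with codomain the object at `j` when `f` maps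
`i` to `j`. -/
def FamHom.homAt {X Y : Fam K D} (f : FamHom X Y) {i : X.I} : ∀ {j : Y.I}, f.index i = j →
    (X.obj i ⟶ Y.obj j)
  | _, rfl => f.hom i

namespace FamCell

variable {X Y Z X' Y' Z' X'' Y'' Z'' : Fam K D}

section

variable {m : FamPro X Y} {n : FamPro X' Y'}

/-- The map on elements given by a cell of families. -/
def map (α : FamCell m n) {i : X.I} {j : Y.I} (a : m.A.Elt i j) :
    n.A.Elt (α.src.index i) (α.tgt.index j) := a.map α.index α.l_index α.r_index

theorem src_index_eq (α : FamCell m n) {i : X.I} {j : Y.I} {i' : X'.I} {j' : Y'.I}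
    (a : m.A.Elt i j) (b : n.A.Elt i' j') (h : α.index a.val = b.val) : α.src.index i = i' := by
  rw [← b.l_val, ← h, α.l_index, a.l_val]

theorem tgt_index_eq (α : FamCell m n) {i : X.I} {j : Y.I} {i' : X'.I} {j' : Y'.I}
    (a : m.A.Elt i j) (b : n.A.Elt i' j') (h : α.index a.val = b.val) : α.tgt.index j = j' := by
  rw [← b.r_val, ← h, α.r_index, a.r_val]

/-- The component of a cell of families at `a`, with codomain the proarrow at `b` when `α` maps
`a` to `b`. -/
def cellAt (α : FamCell m n) {i : X.I} {j : Y.I} {i' : X'.I} {j' : Y'.I}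
    (a : m.A.Elt i j) (b : n.A.Elt i' j') (h : α.index a.val = b.val) :
    Cell (m.pro a) (n.pro b) :=
  match i', j', α.src_index_eq a b h, α.tgt_index_eq a b h, b, h with
  | _, _, rfl, rfl, ⟨_, _, _⟩, rfl => α.cell a

theorem cellAt_map (α : FamCell m n) {i : X.I} {j : Y.I} (a : m.A.Elt i j) :
    α.cellAt a (α.map a) rfl = α.cell a := rfl

theorem src_cellAt (α : FamCell m n) {i : X.I} {j : Y.I} {i' : X'.I} {j' : Y'.I}
    (a : m.A.Elt i j) (b : n.A.Elt i' j') (h : α.index a.val = b.val) :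
    DoubleCategoryStruct.src (α.cellAt a b h) = α.src.homAt (α.src_index_eq a b h) := by
  obtain rfl := α.src_index_eq a b h
  obtain rfl := α.tgt_index_eq a b h
  obtain rfl : b = α.map a := IndexSpan.Elt.ext h.symm
  exact α.src_cell a

theorem tgt_cellAt (α : FamCell m n) {i : X.I} {j : Y.I} {i' : X'.I} {j' : Y'.I}
    (a : m.A.Elt i j) (b : n.A.Elt i' j') (h : α.index a.val = b.val) :
    DoubleCategoryStruct.tgt (α.cellAt a b h) = α.tgt.homAt (α.tgt_index_eq a b h) := by
  obtain rfl := α.src_index_eq a b h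
  obtain rfl := α.tgt_index_eq a b h
  obtain rfl : b = α.map a := IndexSpan.Elt.ext h.symm
  exact α.tgt_cell a

theorem ext {α β : FamCell m n} (hs : α.src = β.src) (ht : α.tgt = β.tgt)
    (hi : ∀ a, α.index a = β.index a)
    (hc : ∀ {i : X.I} {j : Y.I} (a : m.A.Elt i j),
      α.cell a = β.cellAt a (α.map a) (hi a.val).symm) : α = β := by
  obtain ⟨s, t, f, h1, h2, k, h3, h4⟩ := α
  obtain ⟨s', t', f', h1', h2', k', h3', h4'⟩ := β
  obtain rfl : s = s' := hs
  obtain rfl : t = t' := ht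
  obtain rfl : f = f' := funext hi
  obtain rfl : @k = @k' := by
    funext i j a
    exact hc a
  rfl

end

def id (m : FamPro X Y) : FamCell m m where
  src := 𝟙 X
  tgt := 𝟙 Y
  index a := a
  l_index _ := rfl
  r_index _ := rfl
  cell a := cellId (m.pro a)
  src_cell _ := src_id _
  tgt_cell _ := tgt_id _

def comp {m : FamPro X Y} {n : FamPro X' Y'} {k : FamPro X'' Y''}
    (α : FamCell m n) (β : FamCell n k) : FamCell m k where
  src := α.src ≫ β.src
  tgt := α.tgt ≫ β.tgt
  index a := β.index (α.index a)
  l_index a := (β.l_index _).trans (congrArg β.src.index (α.l_index a))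
  r_index a := (β.r_index _).trans (congrArg β.tgt.index (α.r_index a))
  cell a := α.cell a ⋄ β.cell (α.map a)
  src_cell a := (src_comp _ _).trans (congrArg₂ _ (α.src_cell a) (β.src_cell (α.map a)))
  tgt_cell a := (tgt_comp _ _).trans (congrArg₂ _ (α.tgt_cell a) (β.tgt_cell (α.map a)))

/-- The identity cell of an arrow, between identity proarrows. -/
def idCell (f : X ⟶ Y) : ∀ {i j : X.I} (h : i = j),
    Cell (FamPro.idPro X h) (FamPro.idPro Y (congrArg f.index h))
  | i, _, rfl => unitCell (f.hom i)

theorem src_idCell (f : X ⟶ Y) {i j : X.I} (h : i = j) :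
    DoubleCategoryStruct.src (idCell f h) = f.hom i := by
  subst h; exact src_unitCell _

theorem tgt_idCell (f : X ⟶ Y) {i j : X.I} (h : i = j) :
    DoubleCategoryStruct.tgt (idCell f h) = f.hom j := by
  subst h; exact tgt_unitCell _

/-- The external identity of a morphism of families. -/
def unit (f : X ⟶ Y) : FamCell (FamPro.id X) (FamPro.id Y) where
  src := f
  tgt := f
  index i := f.index i
  l_index _ := rfl
  r_index _ := rfl
  cell a := idCell f a.eq_of_id
  src_cell _ := src_idCell _ _
  tgt_cell _ := tgt_idCell _ _

section

variable {m : FamPro X Y} {n : FamPro Y Z} {m' : FamPro X' Y'} {n' : FamPro Y' Z'}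

theorem tgt_cellAt_eq_src_cellAt (α : FamCell m m') (β : FamCell n n') (h : α.tgt = β.src)
    {i : X.I} {j : Y.I} {k : Z.I} {i' : X'.I} {j' : Y'.I} {k' : Z'.I}
    (a : m.A.Elt i j) (b : n.A.Elt j k) (a' : m'.A.Elt i' j') (b' : n'.A.Elt j' k')
    (ha : α.index a.val = a'.val) (hb : β.index b.val = b'.val) :
    DoubleCategoryStruct.tgt (α.cellAt a a' ha) = DoubleCategoryStruct.src (β.cellAt b b' hb) := by
  rw [tgt_cellAt, src_cellAt]
  have key : ∀ (f g : Y ⟶ Y') (_ : f = g) (hf : f.index j = j') (hg : g.index j = j'),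
      FamHom.homAt f hf = FamHom.homAt g hg := by
    rintro f _ rfl _ _; rfl
  exact key _ _ h _ _

/-- The external composite of two components of cells of families. -/
def hcompAt (α : FamCell m m') (β : FamCell n n') (h : α.tgt = β.src)
    {i : X.I} {j : Y.I} {k : Z.I} {i' : X'.I} {j' : Y'.I} {k' : Z'.I}
    (a : m.A.Elt i j) (b : n.A.Elt j k) (a' : m'.A.Elt i' j') (b' : n'.A.Elt j' k')
    (ha : α.index a.val = a'.val) (hb : β.index b.val = b'.val) :
    Cell (m.pro a ⊙ n.pro b) (m'.pro a' ⊙ n'.pro b') :=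
  DoubleCategoryStruct.hcomp (α.cellAt a a' ha) (β.cellAt b b' hb)
    (tgt_cellAt_eq_src_cellAt α β h a b a' b' ha hb)

/-- The external composite of cells of families, computed componentwise. -/
def hcomp (α : FamCell m m') (β : FamCell n n') (h : α.tgt = β.src) :
    FamCell (m.comp n) (m'.comp n') where
  src := α.src
  tgt := β.tgt
  index p := ⟨(α.index p.1.1, β.index p.1.2),
    (α.r_index _).trans ((congrArg₂ FamHom.index h p.2).trans (β.l_index _).symm)⟩
  l_index p := α.l_index p.1.1
  r_index p := β.r_index p.1.2
  cell p := hcompAt α β h p.fst p.snd (p.map _ _ _).fst (p.map _ _ _).snd rfl rfl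
  src_cell _ := (src_hcomp _ _ _).trans (src_cellAt _ _ _ _)
  tgt_cell _ := (tgt_hcomp _ _ _).trans (tgt_cellAt _ _ _ _)

end

def associator {T : Fam K D} (m : FamPro X Y) (n : FamPro Y Z) (k : FamPro Z T) :
    FamCell ((m.comp n).comp k) (m.comp (n.comp k)) where
  src := 𝟙 X
  tgt := 𝟙 T
  index p := ⟨(p.1.1.1.1, ⟨(p.1.1.1.2, p.1.2), p.2⟩), p.1.1.2⟩
  l_index _ := rfl
  r_index _ := rfl
  cell p := DoubleCategoryStruct.associator (m.pro p.fst.fst) (n.pro p.fst.snd) (k.pro p.snd)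
  src_cell _ := src_associator _ _ _
  tgt_cell _ := tgt_associator _ _ _

/-- Components of the left unitor. -/
def leftUnitorAt (m : FamPro X Y) {i i₀ : X.I} {j : Y.I} (h : i = i₀) (a : m.A.Elt i₀ j)
    (b : m.A.Elt i j) (e : a.val = b.val) : Cell (FamPro.idPro X h ⊙ m.pro a) (m.pro b) :=
  match i₀, h, a, b, e with
  | _, rfl, ⟨_, _, _⟩, ⟨_, _, _⟩, rfl => DoubleCategoryStruct.leftUnitor (m.pro _)

/-- Components of the right unitor. -/
def rightUnitorAt (m : FamPro X Y) {i : X.I} {j j₀ : Y.I} (h : j₀ = j) (a : m.A.Elt i j₀)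
    (b : m.A.Elt i j) (e : a.val = b.val) : Cell (m.pro a ⊙ FamPro.idPro Y h) (m.pro b) :=
  match j, h, a, b, e with
  | _, rfl, ⟨_, _, _⟩, ⟨_, _, _⟩, rfl => DoubleCategoryStruct.rightUnitor (m.pro _)

theorem leftUnitorAt_self (m : FamPro X Y) {i : X.I} {j : Y.I} (a : m.A.Elt i j) :
    leftUnitorAt m rfl a a rfl = DoubleCategoryStruct.leftUnitor (m.pro a) := rfl

theorem rightUnitorAt_self (m : FamPro X Y) {i : X.I} {j : Y.I} (a : m.A.Elt i j) :
    rightUnitorAt m rfl a a rfl = DoubleCategoryStruct.rightUnitor (m.pro a) := rfl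

def leftUnitor (m : FamPro X Y) : FamCell ((FamPro.id X).comp m) m where
  src := 𝟙 X
  tgt := 𝟙 Y
  index p := p.1.2
  l_index p := p.2.symm
  r_index _ := rfl
  cell p := leftUnitorAt m p.fst.eq_of_id p.snd
    ⟨p.val.1.2, p.val.2.symm.trans p.l_val, p.r_val⟩ rfl
  src_cell {i j} p := by
    have key : ∀ (i₀ : X.I) (h : i = i₀) (a : m.A.Elt i₀ j) (b : m.A.Elt i j) (e : a.val = b.val),
        DoubleCategoryStruct.src (leftUnitorAt m h a b e) = 𝟙 (X.obj i) := by
      rintro _ rfl a b e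
      obtain rfl := IndexSpan.Elt.ext e
      exact src_leftUnitor _
    exact key _ _ _ _ _
  tgt_cell {i j} p := by
    have key : ∀ (i₀ : X.I) (h : i = i₀) (a : m.A.Elt i₀ j) (b : m.A.Elt i j) (e : a.val = b.val),
        DoubleCategoryStruct.tgt (leftUnitorAt m h a b e) = 𝟙 (Y.obj j) := by
      rintro _ rfl a b e
      obtain rfl := IndexSpan.Elt.ext e
      exact tgt_leftUnitor _
    exact key _ _ _ _ _

def rightUnitor (m : FamPro X Y) : FamCell (m.comp (FamPro.id Y)) m where
  src := 𝟙 X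
  tgt := 𝟙 Y
  index p := p.1.1
  l_index _ := rfl
  r_index p := p.2
  cell p := rightUnitorAt m p.snd.eq_of_id p.fst
    ⟨p.val.1.1, p.l_val, p.val.2.trans p.r_val⟩ rfl
  src_cell {i j} p := by
    have key : ∀ (j₀ : Y.I) (h : j₀ = j) (a : m.A.Elt i j₀) (b : m.A.Elt i j) (e : a.val = b.val),
        DoubleCategoryStruct.src (rightUnitorAt m h a b e) = 𝟙 (X.obj i) := by
      rintro _ rfl a b e
      obtain rfl := IndexSpan.Elt.ext e
      exact src_rightUnitor _
    exact key _ _ _ _ _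
  tgt_cell {i j} p := by
    have key : ∀ (j₀ : Y.I) (h : j₀ = j) (a : m.A.Elt i j₀) (b : m.A.Elt i j) (e : a.val = b.val),
        DoubleCategoryStruct.tgt (rightUnitorAt m h a b e) = 𝟙 (Y.obj j) := by
      rintro _ rfl a b e
      obtain rfl := IndexSpan.Elt.ext e
      exact tgt_rightUnitor _
    exact key _ _ _ _ _

end FamCell

/-- The double category of families in `D`, indexed by spans of sets in the class `K`. -/
instance Fam.struct : DoubleCategoryStruct.{max (w + 1) p, max w v c, max w v} (Fam K D) where
  Pro X Y := FamPro X Y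
  Cell m n := FamCell m n
  src α := α.src
  tgt α := α.tgt
  cellId m := FamCell.id m
  cellComp α β := α.comp β
  proUnit X := FamPro.id X
  unitCell f := FamCell.unit f
  proComp m n := m.comp n
  hcomp α β h := α.hcomp β h
  associator m n k := FamCell.associator m n k
  leftUnitor m := FamCell.leftUnitor m
  rightUnitor m := FamCell.rightUnitor m

namespace FamCell

variable {X Y Z T X' Y' Z' T' X'' Y'' Z'' : Fam K D}

theorem cellAt_comp {m : FamPro X Y} {n : FamPro X' Y'} {k : FamPro X'' Y''}
    (α : FamCell m n) (β : FamCell n k) {i : X.I} {j : Y.I} {i' : X'.I} {j' : Y'.I}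
    {i'' : X''.I} {j'' : Y''.I} (a : m.A.Elt i j) (b : n.A.Elt i' j') (c : k.A.Elt i'' j'')
    (h : α.index a.val = b.val) (h' : β.index b.val = c.val)
    (h'' : (α.comp β).index a.val = c.val) :
    (α.comp β).cellAt a c h'' = α.cellAt a b h ⋄ β.cellAt b c h' := by
  obtain rfl := α.src_index_eq a b h
  obtain rfl := α.tgt_index_eq a b h
  obtain rfl : b = α.map a := IndexSpan.Elt.ext h.symm
  obtain rfl := β.src_index_eq _ c h'
  obtain rfl := β.tgt_index_eq _ c h'
  obtain rfl : c = β.map (α.map a) := IndexSpan.Elt.ext h'.symm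
  rfl

theorem id_comp {m : FamPro X Y} {n : FamPro X' Y'} (α : FamCell m n) : (id m).comp α = α :=
  ext (Category.id_comp _) (Category.id_comp _) (fun _ => rfl) fun a => id_cellComp (α.cell a)

theorem comp_id {m : FamPro X Y} {n : FamPro X' Y'} (α : FamCell m n) : α.comp (id n) = α :=
  ext (Category.comp_id _) (Category.comp_id _) (fun _ => rfl) fun a => cellComp_id (α.cell a)

theorem comp_assoc {X₃ Y₃ : Fam K D} {m : FamPro X Y} {n : FamPro X' Y'} {k : FamPro X'' Y''}
    {l : FamPro X₃ Y₃} (α : FamCell m n) (β : FamCell n k) (γ : FamCell k l) :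
    (α.comp β).comp γ = α.comp (β.comp γ) :=
  ext (Category.assoc _ _ _) (Category.assoc _ _ _) (fun _ => rfl) fun a =>
    cellComp_assoc (α.cell a) (β.cell (α.map a)) (γ.cell (β.map (α.map a)))

theorem unit_id (X : Fam K D) : unit (𝟙 X) = id (FamPro.id X) :=
  ext rfl rfl (fun _ => rfl) fun {i j} a => by
    have key : ∀ h : i = j, idCell (𝟙 X) h = cellId (FamPro.idPro X h) := by
      rintro rfl; exact unitCell_id _
    exact key _

theorem unit_comp (f : X ⟶ Y) (g : Y ⟶ Z) : unit (f ≫ g) = (unit f).comp (unit g) :=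
  ext rfl rfl (fun _ => rfl) fun {i j} a => by
    have key : ∀ h : i = j, idCell (f ≫ g) h = idCell f h ⋄ idCell g (congrArg f.index h) := by
      rintro rfl; exact unitCell_comp _ _
    exact key _

theorem hcomp_id (m : FamPro X Y) (n : FamPro Y Z) : hcomp (id m) (id n) rfl = id (m.comp n) :=
  ext rfl rfl (fun _ => rfl) fun a => DoubleCategoryLaws.hcomp_id (m.pro a.fst) (n.pro a.snd)

theorem hcomp_comp {m : FamPro X Y} {n : FamPro Y Z} {m' : FamPro X' Y'} {n' : FamPro Y' Z'}
    {m'' : FamPro X'' Y''} {n'' : FamPro Y'' Z''}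
    (α : FamCell m m') (β : FamCell n n') (γ : FamCell m' m'') (δ : FamCell n' n'')
    (h : α.tgt = β.src) (h' : γ.tgt = δ.src) :
    hcomp (α.comp γ) (β.comp δ) (congrArg₂ (· ≫ ·) h h') = (hcomp α β h).comp (hcomp γ δ h') :=
  ext rfl rfl (fun _ => rfl) fun {i k} p => by
    have key : ∀ {j : Y.I} {i' : X'.I} {j' : Y'.I} {k' : Z'.I} {i'' : X''.I} {j'' : Y''.I}
        {k'' : Z''.I} (a : m.A.Elt i j) (b : n.A.Elt j k) (a' : m'.A.Elt i' j')
        (b' : n'.A.Elt j' k') (a'' : m''.A.Elt i'' j'') (b'' : n''.A.Elt j'' k'')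
        (ha : α.index a.val = a'.val) (hb : β.index b.val = b'.val)
        (ha' : γ.index a'.val = a''.val) (hb' : δ.index b'.val = b''.val)
        (ha'' : (α.comp γ).index a.val = a''.val) (hb'' : (β.comp δ).index b.val = b''.val),
        hcompAt (α.comp γ) (β.comp δ) (congrArg₂ (· ≫ ·) h h') a b a'' b'' ha'' hb'' =
          hcompAt α β h a b a' b' ha hb ⋄ hcompAt γ δ h' a' b' a'' b'' ha' hb' := by
      intro j i' j' k' i'' j'' k'' a b a' b' a'' b'' ha hb ha' hb' ha'' hb''
      unfold hcompAt
      rw [← DoubleCategoryLaws.hcomp_comp]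
      congr 1
      · exact cellAt_comp α γ a a' a'' ha ha' ha''
      · exact cellAt_comp β δ b b' b'' hb hb' hb''
    exact key p.fst p.snd (p.map _ _ _).fst (p.map _ _ _).snd _ _ rfl rfl rfl rfl rfl rfl

theorem cellAt_hcomp {m : FamPro X Y} {n : FamPro Y Z} {m' : FamPro X' Y'} {n' : FamPro Y' Z'}
    (α : FamCell m m') (β : FamCell n n') (h : α.tgt = β.src) {i : X.I} {k : Z.I} {i' : X'.I}
    {k' : Z'.I} (p : (m.A.comp n.A).Elt i k) (q : (m'.A.comp n'.A).Elt i' k')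
    (hpq : (hcomp α β h).index p.val = q.val) :
    (hcomp α β h).cellAt p q hpq = hcompAt α β h p.fst p.snd q.fst q.snd
      (congrArg (fun x => x.1.1) hpq) (congrArg (fun x => x.1.2) hpq) := by
  obtain rfl := (hcomp α β h).src_index_eq p q hpq
  obtain rfl := (hcomp α β h).tgt_index_eq p q hpq
  obtain rfl : q = (hcomp α β h).map p := IndexSpan.Elt.ext hpq.symm
  rfl

theorem associator_naturality {m : FamPro X Y} {n : FamPro Y Z} {k : FamPro Z T}
    {m' : FamPro X' Y'} {n' : FamPro Y' Z'} {k' : FamPro Z' T'}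
    (α : FamCell m m') (β : FamCell n n') (γ : FamCell k k') (h : α.tgt = β.src)
    (h' : β.tgt = γ.src) :
    (hcomp (hcomp α β h) γ h').comp (associator m' n' k') =
      (associator m n k).comp (hcomp α (hcomp β γ h') h) :=
  ext ((Category.comp_id _).trans (Category.id_comp _).symm)
    ((Category.comp_id _).trans (Category.id_comp _).symm) (fun _ => rfl) fun {i l} p => by
    have key : ∀ {i' : X'.I} {l' : T'.I} (q : ((m'.A.comp n'.A).comp k'.A).Elt i' l')
        (r : (m.A.comp (n.A.comp k.A)).Elt i l) (s : (m'.A.comp (n'.A.comp k'.A)).Elt i' l')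
        (h1 : (hcomp α β h).index p.fst.val = q.fst.val) (h2 : γ.index p.snd.val = q.snd.val)
        (hr : (associator m n k).index p.val = r.val)
        (hs : (associator m' n' k').index q.val = s.val)
        (h3 : α.index r.fst.val = s.fst.val)
        (h4 : (hcomp β γ h').index r.snd.val = s.snd.val),
        hcompAt (hcomp α β h) γ h' p.fst p.snd q.fst q.snd h1 h2 ⋄
            (associator m' n' k').cellAt q s hs =
          (associator m n k).cellAt p r hr ⋄
            hcompAt α (hcomp β γ h') h r.fst r.snd s.fst s.snd h3 h4 := by
      intro i' l' q r s h1 h2 hr hs h3 h4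
      obtain rfl : r = (associator m n k).map p := IndexSpan.Elt.ext hr.symm
      obtain rfl : s = (associator m' n' k').map q := IndexSpan.Elt.ext hs.symm
      have e1 := cellAt_hcomp α β h p.fst q.fst h1
      have e2 := cellAt_hcomp β γ h' ((associator m n k).map p).snd
        ((associator m' n' k').map q).snd h4
      have law := DoubleCategoryLaws.associator_naturality
        (α.cellAt p.fst.fst q.fst.fst (congrArg (fun x => x.1.1) h1))
        (β.cellAt p.fst.snd q.fst.snd (congrArg (fun x => x.1.2) h1))
        (γ.cellAt p.snd q.snd h2) (tgt_cellAt_eq_src_cellAt α β h _ _ _ _ _ _)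
        (tgt_cellAt_eq_src_cellAt β γ h' _ _ _ _ _ _)
      refine Eq.trans ?_ (law.trans ?_)
      · refine congrArg (· ⋄ _) ?_
        unfold hcompAt
        congr 1
      · refine congrArg (_ ⋄ ·) ?_
        have aux : ∀ {x y z x' y' z' : D} {m : Pro x y} {n : Pro y z} {m' : Pro x' y'}
            {n' : Pro y' z'} (a : Cell m m') {b b' : Cell n n'} (_ : b = b')
            (hh : DoubleCategoryStruct.tgt a = DoubleCategoryStruct.src b)
            (hh' : DoubleCategoryStruct.tgt a = DoubleCategoryStruct.src b'),
            DoubleCategoryStruct.hcomp a b hh = DoubleCategoryStruct.hcomp a b' hh' := by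
          rintro _ _ _ _ _ _ _ _ _ _ a b _ rfl _ _; rfl
        exact aux _ e2.symm _ _
    exact key ((hcomp (hcomp α β h) γ h').map p) ((associator m n k).map p)
      ((associator m' n' k').map ((hcomp (hcomp α β h) γ h').map p)) rfl rfl rfl rfl rfl rfl

theorem leftUnitor_naturality {m : FamPro X Y} {m' : FamPro X' Y'} (α : FamCell m m') :
    (hcomp (unit α.src) α rfl).comp (leftUnitor m') = (leftUnitor m).comp α :=
  ext ((Category.comp_id _).trans (Category.id_comp _).symm)
    ((Category.comp_id _).trans (Category.id_comp _).symm) (fun _ => rfl) fun {i j} p => by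
    have aux : ∀ {x y x' y' : D} {m : Pro x y} {m' : Pro x' y'} (a : Cell m m') (f : x ⟶ x')
        (hf : DoubleCategoryStruct.src a = f),
        DoubleCategoryStruct.hcomp (unitCell f) a ((tgt_unitCell f).trans hf.symm) ⋄
          DoubleCategoryStruct.leftUnitor m' = DoubleCategoryStruct.leftUnitor m ⋄ a := by
      rintro _ _ _ _ _ _ a _ rfl
      exact DoubleCategoryLaws.leftUnitor_naturality a
    obtain ⟨⟨⟨i₀, a⟩, h⟩, hl, hr⟩ := p
    change i₀ = m.A.l a at h
    change i₀ = i at hl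
    change m.A.r a = j at hr
    subst h hl hr
    exact aux (α.cell ⟨a, rfl, rfl⟩) (α.src.hom _) (α.src_cell ⟨a, rfl, rfl⟩)

theorem rightUnitor_naturality {m : FamPro X Y} {m' : FamPro X' Y'} (α : FamCell m m') :
    (hcomp α (unit α.tgt) rfl).comp (rightUnitor m') = (rightUnitor m).comp α :=
  ext ((Category.comp_id _).trans (Category.id_comp _).symm)
    ((Category.comp_id _).trans (Category.id_comp _).symm) (fun _ => rfl) fun {i j} p => by
    have aux : ∀ {x y x' y' : D} {m : Pro x y} {m' : Pro x' y'} (a : Cell m m') (f : y ⟶ y')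
        (hf : DoubleCategoryStruct.tgt a = f),
        DoubleCategoryStruct.hcomp a (unitCell f) (hf.trans (src_unitCell f).symm) ⋄
          DoubleCategoryStruct.rightUnitor m' = DoubleCategoryStruct.rightUnitor m ⋄ a := by
      rintro _ _ _ _ _ _ a _ rfl
      exact DoubleCategoryLaws.rightUnitor_naturality a
    have key : ∀ {i' : X'.I} {j' j₀' : Y'.I} (a : m.A.Elt i j) (e : (FamPro.id Y).A.Elt j j)
        (a' : m'.A.Elt i' j₀') (b' : m'.A.Elt i' j') (e' : (FamPro.id Y').A.Elt j₀' j')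
        (hab' : a'.val = b'.val) (he : (unit α.tgt).index e.val = e'.val)
        (ha : α.index a.val = a'.val) (hb : α.index a.val = b'.val),
        hcompAt α (unit α.tgt) rfl a e a' e' ha he ⋄ rightUnitorAt m' e'.eq_of_id a' b' hab' =
          rightUnitorAt m e.eq_of_id a a rfl ⋄ α.cellAt a b' hb := by
      intro i' j' j₀' a e a' b' e' hab' he ha hb
      obtain rfl := e'.eq_of_id
      obtain rfl : a' = b' := IndexSpan.Elt.ext hab'
      obtain rfl := α.src_index_eq a a' ha
      obtain rfl := α.tgt_index_eq a a' ha
      obtain rfl : a' = α.map a := IndexSpan.Elt.ext ha.symm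
      obtain rfl : e = ⟨j, rfl, rfl⟩ := IndexSpan.Elt.ext e.l_val
      obtain rfl : e' = ⟨α.tgt.index j, rfl, rfl⟩ := IndexSpan.Elt.ext e'.l_val
      exact aux (α.cell a) (α.tgt.hom j) (α.tgt_cell a)
    obtain ⟨⟨⟨a, j₀⟩, h⟩, hl, hr⟩ := p
    change m.A.r a = j₀ at h
    change m.A.l a = i at hl
    change j₀ = j at hr
    subst hl hr h
    exact key ⟨a, rfl, rfl⟩ ⟨_, rfl, rfl⟩
      ⟨α.index a, α.l_index a, rfl⟩ (α.map ⟨a, rfl, rfl⟩)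
      ⟨α.tgt.index (m.A.r a), (α.r_index a).symm, rfl⟩ rfl rfl rfl rfl

theorem pentagon {R : Fam K D} (m : FamPro X Y) (n : FamPro Y Z) (k : FamPro Z T)
    (l : FamPro T R) :
    (hcomp (associator m n k) (id l) rfl).comp ((associator m (n.comp k) l).comp
        (hcomp (id m) (associator n k l) rfl)) =
      (associator (m.comp n) k l).comp (associator m n (k.comp l)) :=
  ext (by simp [hcomp, associator, comp, id]) (by simp [hcomp, associator, comp, id]) (fun _ => rfl)
    fun p => DoubleCategoryLaws.pentagon (m.pro p.fst.fst.fst) (n.pro p.fst.fst.snd)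
      (k.pro p.fst.snd) (l.pro p.snd)

theorem triangle (m : FamPro X Y) (n : FamPro Y Z) :
    (associator m (FamPro.id Y) n).comp (hcomp (id m) (leftUnitor n) rfl) =
      hcomp (rightUnitor m) (id n) rfl :=
  ext (Category.comp_id _) (Category.comp_id _) (fun _ => rfl) fun {i k} p => by
    obtain ⟨⟨⟨⟨⟨a, j⟩, h⟩, b⟩, h'⟩, hl, hr⟩ := p
    change m.A.r a = j at h
    change j = n.A.l b at h'
    change m.A.l a = i at hl
    change n.A.r b = k at hr
    subst hl hr h
    exact DoubleCategoryLaws.triangle (m.pro ⟨a, rfl, rfl⟩) (n.pro ⟨b, h'.symm, rfl⟩)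

/-- A globular cell of families that is bijective on indices and componentwise invertible is
invertible. -/
theorem isInvertible {m n : FamPro X Y} (α : FamCell m n) (hs : α.src = 𝟙 X) (ht : α.tgt = 𝟙 Y)
    (g : n.A.apex → m.A.apex) (hg : ∀ a, g (α.index a) = a) (hg' : ∀ b, α.index (g b) = b)
    (hc : ∀ {i : X.I} {j : Y.I} (a : m.A.Elt i j), IsInvertible (α.cell a)) :
    ∃ β : FamCell n m, α.comp β = id m ∧ β.comp α = id n := by
  obtain ⟨s, t, f, hl, hr, c, h3, h4⟩ := α
  obtain rfl : s = 𝟙 X := hs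
  obtain rfl : t = 𝟙 Y := ht
  change ∀ a, g (f a) = a at hg
  change ∀ b, f (g b) = b at hg'
  change ∀ a, n.A.l (f a) = m.A.l a at hl
  change ∀ a, n.A.r (f a) = m.A.r a at hr
  have hc' : ∀ {i : X.I} {j : Y.I} (a : m.A.Elt i j), IsInvertible (c a) := hc
  -- the elements of the two indexing spans correspond
  have hc'' : ∀ {i : X.I} {j : Y.I} (b : n.A.Elt i j) (a : m.A.Elt i j) (h : f a.val = b.val),
      ∃ d : Cell (n.pro b) (m.pro a),
        FamCell.cellAt ⟨𝟙 X, 𝟙 Y, f, hl, hr, c, h3, h4⟩ a b h ⋄ d = cellId _ ∧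
          d ⋄ FamCell.cellAt ⟨𝟙 X, 𝟙 Y, f, hl, hr, c, h3, h4⟩ a b h = cellId _ := by
    intro i j b a h
    obtain rfl : b = ⟨f a.val, (hl _).trans a.l_val, (hr _).trans a.r_val⟩ :=
      IndexSpan.Elt.ext h.symm
    exact hc' a
  choose d hd hd' using @hc''
  have hsd : ∀ {i : X.I} {j : Y.I} (b : n.A.Elt i j) (a : m.A.Elt i j) (h : f a.val = b.val),
      DoubleCategoryStruct.src (d b a h) = 𝟙 _ := by
    intro i j b a h
    have e := congrArg DoubleCategoryStruct.src (hd' b a h)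
    rw [src_comp, src_cellAt, src_id] at e
    exact (Category.comp_id _).symm.trans e
  have htd : ∀ {i : X.I} {j : Y.I} (b : n.A.Elt i j) (a : m.A.Elt i j) (h : f a.val = b.val),
      DoubleCategoryStruct.tgt (d b a h) = 𝟙 _ := by
    intro i j b a h
    have e := congrArg DoubleCategoryStruct.tgt (hd' b a h)
    rw [tgt_comp, tgt_cellAt, tgt_id] at e
    exact (Category.comp_id _).symm.trans e
  refine ⟨⟨𝟙 X, 𝟙 Y, g, fun b => ?_, fun b => ?_, fun b => d b _ (hg' b.val), fun b => hsd _ _ _,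
    fun b => htd _ _ _⟩, ?_, ?_⟩
  · change m.A.l (g b) = n.A.l b
    rw [← hl, hg']
  · change m.A.r (g b) = n.A.r b
    rw [← hr, hg']
  · refine ext (Category.comp_id _) (Category.comp_id _) hg fun {i j} a => ?_
    have key : ∀ (a' : m.A.Elt i j) (h : a.val = a'.val) (b : n.A.Elt i j) (hb : f a.val = b.val)
        (hb' : f a'.val = b.val),
        FamCell.cellAt ⟨𝟙 X, 𝟙 Y, f, hl, hr, c, h3, h4⟩ a b hb ⋄ d b a' hb' =
          (id m).cellAt a a' h := by
      intro a' h b hb hb'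
      obtain rfl : a = a' := IndexSpan.Elt.ext h
      exact hd b a hb'
    exact key ⟨g (f a.val), (congrArg m.A.l (hg _)).trans a.l_val,
      (congrArg m.A.r (hg _)).trans a.r_val⟩ (hg a.val).symm
      ⟨f a.val, (hl _).trans a.l_val, (hr _).trans a.r_val⟩ rfl
      (congrArg f (hg a.val))
  · refine ext (Category.comp_id _) (Category.comp_id _) hg' fun {i j} b => ?_
    have key : ∀ (b' : n.A.Elt i j) (h : b.val = b'.val) (a : m.A.Elt i j) (hb : f a.val = b.val)
        (hb' : f a.val = b'.val),
        d b a hb ⋄ FamCell.cellAt ⟨𝟙 X, 𝟙 Y, f, hl, hr, c, h3, h4⟩ a b' hb' =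
          (id n).cellAt b b' h := by
      intro b' h a hb hb'
      obtain rfl : b = b' := IndexSpan.Elt.ext h
      exact hd' b a hb'
    exact key ⟨f (g b.val), (congrArg n.A.l (hg' _)).trans b.l_val,
      (congrArg n.A.r (hg' _)).trans b.r_val⟩ (hg' b.val).symm
      ⟨g b.val, by rw [← hl, hg', b.l_val], by rw [← hr, hg', b.r_val]⟩ (hg' b.val) rfl

theorem isInvertible_associator (m : FamPro X Y) (n : FamPro Y Z) (k : FamPro Z T) :
    ∃ β, (associator m n k).comp β = id _ ∧ β.comp (associator m n k) = id _ :=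
  isInvertible _ rfl rfl
    (fun p => ⟨(⟨(p.1.1, p.1.2.1.1), p.2⟩, p.1.2.1.2), p.1.2.2⟩) (fun _ => rfl) (fun _ => rfl)
    fun _ => DoubleCategoryLaws.isInvertible_associator _ _ _

theorem isInvertible_leftUnitor (m : FamPro X Y) :
    ∃ β, (leftUnitor m).comp β = id _ ∧ β.comp (leftUnitor m) = id _ :=
  isInvertible (leftUnitor m) rfl rfl (fun a => ⟨(m.A.l a, a), rfl⟩)
    (fun p => Subtype.ext (Prod.ext p.2.symm rfl)) (fun _ => rfl) fun {i j} p => by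
    obtain ⟨⟨⟨i₀, a⟩, h⟩, hl, hr⟩ := p
    change i₀ = m.A.l a at h
    change i₀ = i at hl
    change m.A.r a = j at hr
    subst h hl hr
    exact DoubleCategoryLaws.isInvertible_leftUnitor (m.pro ⟨a, rfl, rfl⟩)

theorem isInvertible_rightUnitor (m : FamPro X Y) :
    ∃ β, (rightUnitor m).comp β = id _ ∧ β.comp (rightUnitor m) = id _ :=
  isInvertible (rightUnitor m) rfl rfl (fun a => ⟨(a, m.A.r a), rfl⟩)
    (fun p => Subtype.ext (Prod.ext rfl p.2)) (fun _ => rfl) fun {i j} p => by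
    obtain ⟨⟨⟨a, j₀⟩, h⟩, hl, hr⟩ := p
    change m.A.r a = j₀ at h
    change m.A.l a = i at hl
    change j₀ = j at hr
    subst hl hr h
    exact DoubleCategoryLaws.isInvertible_rightUnitor (m.pro ⟨a, rfl, rfl⟩)

end FamCell

instance : DoubleCategory.{max (w + 1) p, max w v c, max w v} (Fam K D) where
  id_cellComp α := FamCell.id_comp α
  cellComp_id α := FamCell.comp_id α
  cellComp_assoc α β γ := FamCell.comp_assoc α β γ
  src_id _ := rfl
  tgt_id _ := rfl
  src_comp _ _ := rfl
  tgt_comp _ _ := rfl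
  src_unitCell _ := rfl
  tgt_unitCell _ := rfl
  unitCell_id x := FamCell.unit_id x
  unitCell_comp f g := FamCell.unit_comp f g
  src_hcomp _ _ _ := rfl
  tgt_hcomp _ _ _ := rfl
  hcomp_id m n := FamCell.hcomp_id m n
  hcomp_comp α β γ δ h h' := FamCell.hcomp_comp α β γ δ h h'
  src_associator _ _ _ := rfl
  tgt_associator _ _ _ := rfl
  src_leftUnitor _ := rfl
  tgt_leftUnitor _ := rfl
  src_rightUnitor _ := rfl
  tgt_rightUnitor _ := rfl
  isInvertible_associator m n k := FamCell.isInvertible_associator m n k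
  isInvertible_leftUnitor m := FamCell.isInvertible_leftUnitor m
  isInvertible_rightUnitor m := FamCell.isInvertible_rightUnitor m
  associator_naturality α β γ h h' := FamCell.associator_naturality α β γ h h'
  leftUnitor_naturality α := FamCell.leftUnitor_naturality α
  rightUnitor_naturality α := FamCell.rightUnitor_naturality α
  pentagon m n k l := FamCell.pentagon m n k l
  triangle m n := FamCell.triangle m n

/-! ## Coproducts in double categories -/

variable (K D)

/-- The double functor sending objects and proarrows of `D` to singleton families. -/
def delta : ColaxFunctor D (Fam K D) where
  obj x := ⟨PUnit, K.punit, fun _ => x⟩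
  map f := ⟨fun i => i, fun _ => f⟩
  map_id _ := rfl
  map_comp _ _ := rfl
  mapPro m := ⟨⟨PUnit, K.punit, fun i => i, fun i => i⟩, fun _ => m⟩
  mapCell α := ⟨⟨fun i => i, fun _ => src α⟩, ⟨fun i => i, fun _ => tgt α⟩, fun i => i,
    fun _ => rfl, fun _ => rfl, fun _ => α, fun _ => rfl, fun _ => rfl⟩
  src_mapCell _ := rfl
  tgt_mapCell _ := rfl
  mapCell_id m := FamCell.ext (congrArg (FamHom.mk _) (funext fun _ => src_id m))
    (congrArg (FamHom.mk _) (funext fun _ => tgt_id m)) (fun _ => rfl) fun _ => rfl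
  mapCell_comp α β := FamCell.ext (congrArg (FamHom.mk _) (funext fun _ => src_comp α β))
    (congrArg (FamHom.mk _) (funext fun _ => tgt_comp α β)) (fun _ => rfl) fun _ => rfl
  compCell m n := ⟨𝟙 _, 𝟙 _, fun i => ⟨(i, i), rfl⟩, fun _ => rfl, fun _ => rfl,
    fun _ => cellId (m ⊙ n), fun _ => src_id _, fun _ => tgt_id _⟩
  idCell x := ⟨𝟙 _, 𝟙 _, fun i => i, fun _ => rfl, fun _ => rfl,
    fun _ => cellId (proUnit x), fun _ => src_id _, fun _ => tgt_id _⟩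
  src_compCell _ _ := rfl
  tgt_compCell _ _ := rfl
  src_idCell _ := rfl
  tgt_idCell _ := rfl
  compCell_naturality α β h := FamCell.ext
    (congrArg (FamHom.mk _) (funext fun _ => (Category.comp_id _).trans
      ((src_hcomp α β h).trans (Category.id_comp _).symm)))
    (congrArg (FamHom.mk _) (funext fun _ => (Category.comp_id _).trans
      ((tgt_hcomp α β h).trans (Category.id_comp _).symm)))
    (fun _ => rfl) fun _ => (cellComp_id (hcomp α β h)).trans (id_cellComp (hcomp α β h)).symm
  idCell_naturality f := FamCell.ext
    (congrArg (FamHom.mk _) (funext fun _ => (Category.comp_id _).trans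
      ((src_unitCell f).trans (Category.id_comp _).symm)))
    (congrArg (FamHom.mk _) (funext fun _ => (Category.comp_id _).trans
      ((tgt_unitCell f).trans (Category.id_comp _).symm)))
    (fun _ => rfl) fun _ => (cellComp_id (unitCell f)).trans (id_cellComp (unitCell f)).symm
  coassociativity {x y z t} m n k := by
    have hs : src (associator m n k) ≫ 𝟙 x ≫ 𝟙 x = 𝟙 x ≫ 𝟙 x ≫ 𝟙 x := by simp
    have ht : tgt (associator m n k) ≫ 𝟙 t ≫ 𝟙 t = 𝟙 t ≫ 𝟙 t ≫ 𝟙 t := by simp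
    have hc : associator m n k ⋄ cellId (m ⊙ n ⊙ k) ⋄ hcomp (cellId m) (cellId (n ⊙ k)) (by simp) =
        cellId ((m ⊙ n) ⊙ k) ⋄ hcomp (cellId (m ⊙ n)) (cellId k) (by simp) ⋄
          associator m n k := by
      simp [DoubleCategoryLaws.hcomp_id]
    exact FamCell.ext (congrArg (FamHom.mk _) (funext fun _ => hs))
      (congrArg (FamHom.mk _) (funext fun _ => ht)) (fun _ => rfl) fun _ => hc
  left_counitality {x y} m := by
    have hs : src (leftUnitor m) = 𝟙 x ≫ 𝟙 x ≫ 𝟙 x := by simp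
    have ht : tgt (leftUnitor m) = 𝟙 y ≫ 𝟙 y ≫ 𝟙 y := by simp
    have hc : leftUnitor m = cellId (proUnit x ⊙ m) ⋄
        hcomp (cellId (proUnit x)) (cellId m) (by simp) ⋄ leftUnitor m := by
      simp [DoubleCategoryLaws.hcomp_id]
    exact FamCell.ext (congrArg (FamHom.mk _) (funext fun _ => hs))
      (congrArg (FamHom.mk _) (funext fun _ => ht)) (fun _ => rfl) fun _ => hc
  right_counitality {x y} m := by
    have hs : src (rightUnitor m) = 𝟙 x ≫ 𝟙 x ≫ 𝟙 x := by simp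
    have ht : tgt (rightUnitor m) = 𝟙 y ≫ 𝟙 y ≫ 𝟙 y := by simp
    have hc : rightUnitor m = cellId (m ⊙ proUnit y) ⋄
        hcomp (cellId m) (cellId (proUnit y)) (by simp) ⋄ rightUnitor m := by
      simp [DoubleCategoryLaws.hcomp_id]
    exact FamCell.ext (congrArg (FamHom.mk _) (funext fun _ => hs))
      (congrArg (FamHom.mk _) (funext fun _ => ht)) (fun _ => rfl) fun _ => hc

theorem delta_isPseudo : (delta K D).IsPseudo :=
  ⟨fun _ _ => FamCell.isInvertible _ rfl rfl (fun _ => PUnit.unit) (fun _ => rfl) (fun _ => rfl)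
    fun _ => ⟨cellId _, id_cellComp _, id_cellComp _⟩,
  fun _ => FamCell.isInvertible _ rfl rfl (fun _ => PUnit.unit) (fun _ => rfl) (fun _ => rfl)
    fun _ => ⟨cellId _, id_cellComp _, id_cellComp _⟩⟩

end Families

/-- `D` has colax coproducts, indexed by sets in the class `K`, if the double functor `delta` has
a colax left adjoint. -/
def HasColaxCoproductsOf (K : IndexClass.{w}) (D : Type u) [DoubleCategory.{p, c, v} D] : Prop :=
  ∃ F : ColaxFunctor (Fam K D) D, Nonempty (ColaxFunctor.Adjunction F (delta K D))

/-- `D` has strong coproducts, indexed by sets in the class `K`, if the double functor `delta` has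
a pseudo left adjoint. -/
def HasStrongCoproductsOf (K : IndexClass.{w}) (D : Type u) [DoubleCategory.{p, c, v} D] : Prop :=
  ∃ F : ColaxFunctor (Fam K D) D, F.IsPseudo ∧
    Nonempty (ColaxFunctor.Adjunction F (delta K D))

/-- Colax coproducts of families indexed by arbitrary sets in `Type w`. -/
def HasColaxCoproducts (D : Type u) [DoubleCategory.{p, c, v} D] : Prop :=
  HasColaxCoproductsOf IndexClass.all.{w} D

/-- Colax coproducts of families indexed by finite sets. -/
def HasColaxFiniteCoproducts (D : Type u) [DoubleCategory.{p, c, v} D] : Prop :=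
  HasColaxCoproductsOf IndexClass.finite.{w} D

/-- Strong coproducts of families indexed by arbitrary sets in `Type w`. -/
def HasStrongCoproducts (D : Type u) [DoubleCategory.{p, c, v} D] : Prop :=
  HasStrongCoproductsOf IndexClass.all.{w} D

/-- Strong coproducts of families indexed by finite sets. -/
def HasStrongFiniteCoproducts (D : Type u) [DoubleCategory.{p, c, v} D] : Prop :=
  HasStrongCoproductsOf IndexClass.finite.{w} D

/-- A category with pullbacks is (infinitary) extensive if it has all coproducts indexed by sets in
`Type w`, and these are van Kampen: for a map from a cocone to a coproduct cocone of `X`, the cocone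
is a coproduct cocone if and only if all squares of the map are pullbacks. -/
class InfinitaryExtensive (S : Type u) [Category.{v} S] [HasPullbacks S] : Prop where
  hasCoproducts : HasCoproducts.{w} S
  vanKampen : ∀ {ι : Type w} (X : ι → S) (c : Cofan X), IsColimit c → IsVanKampenColimit c

end Dbl

namespace Dbl

open DoubleCategoryStruct DoubleCategoryLaws

/-! A class `K` of index sets treats small and finite coproducts at once. The left adjoint
`sumFunctor` sends a family of objects to its coproduct, and a family of spans `m_a` from `x_i` to
`y_j` to the span whose apex is the coproduct of the apexes, with legs induced by the legs of the
`m_a`. External composition need not be preserved: the inclusions only induce a map from the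
coproduct of the pullbacks `m_a ×_{y_j} n_b`, over the pairs `(a, b)` that meet at some `j`, to the
pullback of `∐ m_a` and `∐ n_b` over `∐ y_j`. This is `sumCompHom`, the composition comparison of a
colax functor. All colax laws are equalities of maps out of a coproduct, often into a pullback, so
they are checked on inclusions and projections. The unit of the adjunction consists of the coproduct
inclusions, the counit of the codiagonals of singleton families (`sumAdjunction`). This gives the
colax statements.

For the strong statements the point is `isIso_sumCompHom`. By universality of coproducts, the
pullback `P` of `∐ m_a` and `∐ n_b` over `∐ y_j` is the coproduct of its pieces `P_ab` lying over
`m_a` and `n_b`. If `a` ends where `b` starts, at `j`, then `P_ab` maps to `m_a ×_{y_j} n_b`,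
because the inclusion of `y_j` in the coproduct is monic. If they do not meet, disjointness makes
`P_ab` initial (`sigma.nonempty_isInitial_of_ne`), so such pieces do not matter. The maps on the
pieces glue to an inverse (`exists_comp_sumCompHom_eq` carries the case distinction). The identity
comparison is inverted directly by the universal property of coproducts.

For sets, the van Kampen property is an elementwise check, a cofan of types being a coproduct
exactly when the map from the sigma type is bijective. Finite sets inherit extensivity along their
inclusion in sets. -/

/-- The category `S` has coproducts of families indexed by the sets in the class `K`. -/
class HasCoproductsOfClass (K : IndexClass.{w}) (S : Type u) [Category.{v} S] : Prop where
  hasCoproductsOfShape : ∀ ι : Type w, K.mem ι → HasCoproductsOfShape ι S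

/-! ### Coproducts indexed by a class of sets. -/

section Coproducts

variable {K : IndexClass.{w}} {S : Type u} [Category.{v} S] [HasCoproductsOfClass K S]

/-- The coproduct of a family indexed by a set in the class `K`. -/
noncomputable def sigma {ι : Type w} (h : K.mem ι) (X : ι → S) : S :=
  haveI := HasCoproductsOfClass.hasCoproductsOfShape (S := S) ι h
  ∐ X

namespace sigma

variable {ι : Type w} {h : K.mem ι} {X : ι → S}

/-- The coproduct inclusions. -/
noncomputable def inj (h : K.mem ι) (X : ι → S) (i : ι) : X i ⟶ sigma h X :=
  haveI := HasCoproductsOfClass.hasCoproductsOfShape (S := S) ι h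
  Sigma.ι X i

/-- The coproduct inclusions form a colimit cofan. -/
noncomputable def isColimit (h : K.mem ι) (X : ι → S) :
    IsColimit (Cofan.mk (sigma h X) (inj h X)) :=
  haveI := HasCoproductsOfClass.hasCoproductsOfShape (S := S) ι h
  coproductIsCoproduct X

/-- The map out of a coproduct with given components. -/
noncomputable def desc {T : S} (f : ∀ i, X i ⟶ T) : sigma h X ⟶ T :=
  Cofan.IsColimit.desc (isColimit h X) f

theorem inj_desc {T : S} (f : ∀ i, X i ⟶ T) (i : ι) : inj h X i ≫ desc f = f i :=
  Cofan.IsColimit.fac (isColimit h X) f i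

theorem hom_ext {T : S} {f g : sigma h X ⟶ T} (H : ∀ i, inj h X i ≫ f = inj h X i ≫ g) : f = g :=
  Cofan.IsColimit.hom_ext (isColimit h X) f g H

end sigma

end Coproducts

/-! ### Coproducts of families of objects and of spans, and the comparison maps. -/

section Sum

variable {K : IndexClass.{w}} {S : Type u} [Category.{v} S] [HasPullbacks S]

/-- A component of a family of spans, as a span. -/
abbrev FamPro.span {X Y : Fam K (SpanCat S)} (m : FamPro X Y) {i : X.I} {j : Y.I}
    (a : m.A.Elt i j) : SpanPro (X.obj i).obj (Y.obj j).obj := m.pro a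

/-- A component of a morphism of families, as a morphism of `S`. -/
abbrev FamHom.arr {X Y : Fam K (SpanCat S)} (f : FamHom X Y) (i : X.I) :
    (X.obj i).obj ⟶ (Y.obj (f.index i)).obj := f.hom i

/-- A component of a cell of families of spans, as a map of spans. -/
noncomputable abbrev FamCell.spanCell {X Y X' Y' : Fam K (SpanCat S)}
    {m : FamPro X Y} {n : FamPro X' Y'}
    (α : FamCell m n) {i : X.I} {j : Y.I} (a : m.A.Elt i j) :
    SpanCell (m.span a) (n.span (α.map a)) := α.cell a

variable [HasCoproductsOfClass K S]

set_option linter.unusedSectionVars false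

namespace Fam

variable {X Y Z : Fam K (SpanCat S)}

/-- The coproduct of a family of objects. -/
noncomputable def sum (X : Fam K (SpanCat S)) : S := sigma X.mem fun i => (X.obj i).obj

noncomputable def inc (X : Fam K (SpanCat S)) (i : X.I) : (X.obj i).obj ⟶ X.sum :=
  sigma.inj X.mem (fun i => (X.obj i).obj) i

noncomputable def desc {T : S} (f : ∀ i, (X.obj i).obj ⟶ T) : X.sum ⟶ T := sigma.desc f

@[simp] theorem inc_desc {T : S} (f : ∀ i, (X.obj i).obj ⟶ T) (i : X.I) :
    X.inc i ≫ desc f = f i := sigma.inj_desc f i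

@[simp] theorem inc_desc_assoc {T T' : S} (f : ∀ i, (X.obj i).obj ⟶ T) (i : X.I) (g : T ⟶ T') :
    X.inc i ≫ desc f ≫ g = f i ≫ g := by rw [← Category.assoc, inc_desc]

theorem hom_ext {T : S} {f g : X.sum ⟶ T} (h : ∀ i, X.inc i ≫ f = X.inc i ≫ g) : f = g :=
  sigma.hom_ext h

/-- The map of coproducts induced by a morphism of families. -/
noncomputable def sumMap (f : FamHom X Y) : X.sum ⟶ Y.sum :=
  desc fun i => f.arr i ≫ Y.inc (f.index i)

@[simp] theorem inc_sumMap (f : FamHom X Y) (i : X.I) :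
    X.inc i ≫ sumMap f = f.arr i ≫ Y.inc (f.index i) := inc_desc _ _

@[simp] theorem inc_sumMap_assoc (f : FamHom X Y) (i : X.I) {T : S} (g : Y.sum ⟶ T) :
    X.inc i ≫ sumMap f ≫ g = f.arr i ≫ Y.inc (f.index i) ≫ g := by
  rw [← Category.assoc, inc_sumMap, Category.assoc]

theorem sumMap_id : sumMap (𝟙 X : X ⟶ X) = 𝟙 X.sum :=
  hom_ext fun i => by
    rw [inc_sumMap, Category.comp_id]
    exact Category.id_comp (X.inc i)

theorem sumMap_comp (f : X ⟶ Y) (g : Y ⟶ Z) : sumMap (f ≫ g) = sumMap f ≫ sumMap g :=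
  hom_ext fun i => by
    rw [inc_sumMap, inc_sumMap_assoc, inc_sumMap]
    exact Category.assoc _ _ _

end Fam

namespace FamPro

variable {X Y Z : Fam K (SpanCat S)}

/-- The coproduct of a family of spans. -/
noncomputable def sum (m : FamPro X Y) : SpanPro X.sum Y.sum where
  -- The coproduct runs over the whole apex of the indexing span, each `a` being read as an element
  -- between its own feet; no equality of indices is needed here.
  apex := sigma (K := K) m.A.mem fun a => (m.span ⟨a, rfl, rfl⟩).apex
  l := sigma.desc (h := m.A.mem) fun a => (m.span ⟨a, rfl, rfl⟩).l ≫ X.inc (m.A.l a)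
  r := sigma.desc (h := m.A.mem) fun a => (m.span ⟨a, rfl, rfl⟩).r ≫ Y.inc (m.A.r a)

/-- The coproduct inclusions, into the apex of the coproduct of a family of spans. -/
noncomputable def inc (m : FamPro X Y) : ∀ {i : X.I} {j : Y.I} (a : m.A.Elt i j),
    (m.span a).apex ⟶ m.sum.apex
  | _, _, ⟨a, rfl, rfl⟩ => sigma.inj m.A.mem (fun a => (m.span ⟨a, rfl, rfl⟩).apex) a

/-- Only the values of `f` at elements between their own feet enter. Every element has this form
after substituting its feet, which is why `inc_desc` holds for arbitrary feet. -/
noncomputable def desc {m : FamPro X Y} {T : S}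
    (f : ∀ {i : X.I} {j : Y.I} (a : m.A.Elt i j), (m.span a).apex ⟶ T) : m.sum.apex ⟶ T :=
  sigma.desc (h := m.A.mem) fun a => f ⟨a, rfl, rfl⟩

variable (m : FamPro X Y)

@[simp] theorem inc_l {i : X.I} {j : Y.I} (a : m.A.Elt i j) :
    m.inc a ≫ m.sum.l = (m.span a).l ≫ X.inc i := by
  obtain ⟨a, rfl, rfl⟩ := a
  exact sigma.inj_desc (h := m.A.mem) _ a

@[simp] theorem inc_r {i : X.I} {j : Y.I} (a : m.A.Elt i j) :
    m.inc a ≫ m.sum.r = (m.span a).r ≫ Y.inc j := by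
  obtain ⟨a, rfl, rfl⟩ := a
  exact sigma.inj_desc (h := m.A.mem) _ a

@[simp] theorem inc_l_assoc {i : X.I} {j : Y.I} (a : m.A.Elt i j) {T : S} (g : X.sum ⟶ T) :
    m.inc a ≫ m.sum.l ≫ g = (m.span a).l ≫ X.inc i ≫ g := by
  rw [← Category.assoc, inc_l, Category.assoc]

@[simp] theorem inc_r_assoc {i : X.I} {j : Y.I} (a : m.A.Elt i j) {T : S} (g : Y.sum ⟶ T) :
    m.inc a ≫ m.sum.r ≫ g = (m.span a).r ≫ Y.inc j ≫ g := by
  rw [← Category.assoc, inc_r, Category.assoc]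

variable {m}

@[simp] theorem inc_desc {T : S}
    (f : ∀ {i : X.I} {j : Y.I} (a : m.A.Elt i j), (m.span a).apex ⟶ T) {i : X.I} {j : Y.I}
    (a : m.A.Elt i j) : m.inc a ≫ desc f = f a := by
  obtain ⟨a, rfl, rfl⟩ := a
  exact sigma.inj_desc (h := m.A.mem) _ a

@[simp] theorem inc_desc_assoc {T T' : S}
    (f : ∀ {i : X.I} {j : Y.I} (a : m.A.Elt i j), (m.span a).apex ⟶ T) {i : X.I} {j : Y.I}
    (a : m.A.Elt i j) (g : T ⟶ T') : m.inc a ≫ desc f ≫ g = f a ≫ g := by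
  rw [← Category.assoc, inc_desc]

theorem hom_ext {T : S} {f g : m.sum.apex ⟶ T}
    (h : ∀ {i : X.I} {j : Y.I} (a : m.A.Elt i j), m.inc a ≫ f = m.inc a ≫ g) : f = g :=
  sigma.hom_ext (h := m.A.mem) fun a => h ⟨a, rfl, rfl⟩

end FamPro

namespace FamCell

variable {X Y Z X' Y' Z' X'' Y'' : Fam K (SpanCat S)}

theorem spanCell_src {m : FamPro X Y} {n : FamPro X' Y'} (α : FamCell m n) {i : X.I} {j : Y.I}
    (a : m.A.Elt i j) : (α.spanCell a).src = FamHom.arr α.src i := α.src_cell a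

theorem spanCell_tgt {m : FamPro X Y} {n : FamPro X' Y'} (α : FamCell m n) {i : X.I} {j : Y.I}
    (a : m.A.Elt i j) : (α.spanCell a).tgt = FamHom.arr α.tgt j := α.tgt_cell a

/-- The map of coproducts of spans induced by a cell of families. -/
noncomputable def sum {m : FamPro X Y} {n : FamPro X' Y'} (α : FamCell m n) :
    SpanCell m.sum n.sum where
  src := Fam.sumMap α.src
  tgt := Fam.sumMap α.tgt
  hom := FamPro.desc fun a => (α.spanCell a).hom ≫ n.inc (α.map a)
  hom_l := FamPro.hom_ext fun a => by simp [spanCell_src]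
  hom_r := FamPro.hom_ext fun a => by simp [spanCell_tgt]

@[simp] theorem inc_sum_hom {m : FamPro X Y} {n : FamPro X' Y'} (α : FamCell m n) {i : X.I}
    {j : Y.I} (a : m.A.Elt i j) :
    m.inc a ≫ α.sum.hom = (α.spanCell a).hom ≫ n.inc (α.map a) :=
  FamPro.inc_desc (fun a => (α.spanCell a).hom ≫ n.inc (α.map a)) a

@[simp] theorem inc_sum_hom_assoc {m : FamPro X Y} {n : FamPro X' Y'} (α : FamCell m n) {i : X.I}
    {j : Y.I} (a : m.A.Elt i j) {T : S} (g : n.sum.apex ⟶ T) :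
    m.inc a ≫ α.sum.hom ≫ g = (α.spanCell a).hom ≫ n.inc (α.map a) ≫ g := by
  rw [← Category.assoc, inc_sum_hom, Category.assoc]

/-- A component of a cell of families of spans, as a map of spans, with codomain the span at `b`
when the cell maps `a` to `b`. -/
noncomputable abbrev spanCellAt {m : FamPro X Y} {n : FamPro X' Y'}
    (α : FamCell m n) {i : X.I} {j : Y.I} {i' : X'.I} {j' : Y'.I} (a : m.A.Elt i j)
    (b : n.A.Elt i' j') (h : α.index a.val = b.val) : SpanCell (m.span a) (n.span b) :=
  α.cellAt a b h

/-- Transport along an equality of indices becomes invisible after inclusion in the coproduct, so a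
component of a cell may be aimed at whichever form of the image element is convenient. -/
theorem spanCellAt_hom_inc {m : FamPro X Y} {n : FamPro X' Y'} (α : FamCell m n) {i : X.I} {j : Y.I}
    {i' : X'.I} {j' : Y'.I} (a : m.A.Elt i j) (b : n.A.Elt i' j') (h : α.index a.val = b.val) :
    (α.spanCellAt a b h).hom ≫ n.inc b = (α.spanCell a).hom ≫ n.inc (α.map a) := by
  obtain rfl := α.src_index_eq a b h
  obtain rfl := α.tgt_index_eq a b h
  obtain rfl : b = α.map a := IndexSpan.Elt.ext h.symm
  rfl

theorem sum_id (m : FamPro X Y) : (id m).sum = SpanCell.id m.sum :=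
  SpanCell.ext Fam.sumMap_id Fam.sumMap_id <| FamPro.hom_ext fun a => by
    rw [inc_sum_hom, SpanCell.id_hom, Category.comp_id]
    exact Category.id_comp (m.inc a)

theorem sum_comp {m : FamPro X Y} {n : FamPro X' Y'} {k : FamPro X'' Y''}
    (α : FamCell m n) (β : FamCell n k) : (α.comp β).sum = α.sum.comp β.sum :=
  SpanCell.ext (Fam.sumMap_comp _ _) (Fam.sumMap_comp _ _) <| FamPro.hom_ext fun a => by
    rw [inc_sum_hom, SpanCell.comp_hom, inc_sum_hom_assoc, inc_sum_hom]
    exact Category.assoc _ _ _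

/-- The coproduct inclusions into the apex of the coproduct of a composite. -/
noncomputable def incComp (m : FamPro X Y) (n : FamPro Y Z) {i : X.I} {k : Z.I}
    (p : (m.A.comp n.A).Elt i k) :
    ((m.span p.fst).comp (n.span p.snd)).apex ⟶ (m.comp n).sum.apex := (m.comp n).inc p

theorem incComp_l (m : FamPro X Y) (n : FamPro Y Z) {i : X.I} {k : Z.I}
    (p : (m.A.comp n.A).Elt i k) : incComp m n p ≫ (m.comp n).sum.l =
      (m.span p.fst).fst (n.span p.snd) ≫ (m.span p.fst).l ≫ X.inc i :=
  (FamPro.inc_l (m.comp n) p).trans (Category.assoc _ _ _)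

theorem incComp_r (m : FamPro X Y) (n : FamPro Y Z) {i : X.I} {k : Z.I}
    (p : (m.A.comp n.A).Elt i k) : incComp m n p ≫ (m.comp n).sum.r =
      (m.span p.fst).snd (n.span p.snd) ≫ (n.span p.snd).r ≫ Z.inc k :=
  (FamPro.inc_r (m.comp n) p).trans (Category.assoc _ _ _)

/-- The universal property with the summands displayed as composites of spans, so that the lemmas on
pullback projections apply to them. -/
noncomputable def descComp {m : FamPro X Y} {n : FamPro Y Z} {T : S}
    (f : ∀ {i : X.I} {k : Z.I} (p : (m.A.comp n.A).Elt i k),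
      ((m.span p.fst).comp (n.span p.snd)).apex ⟶ T) : (m.comp n).sum.apex ⟶ T :=
  FamPro.desc (m := m.comp n) f

theorem incComp_descComp {m : FamPro X Y} {n : FamPro Y Z} {T : S}
    (f : ∀ {i : X.I} {k : Z.I} (p : (m.A.comp n.A).Elt i k),
      ((m.span p.fst).comp (n.span p.snd)).apex ⟶ T) {i : X.I} {k : Z.I}
    (p : (m.A.comp n.A).Elt i k) : incComp m n p ≫ descComp f = f p :=
  FamPro.inc_desc (m := m.comp n) f p

theorem comp_hom_ext {m : FamPro X Y} {n : FamPro Y Z} {T : S} {f g : (m.comp n).sum.apex ⟶ T}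
    (h : ∀ {i : X.I} {k : Z.I} (p : (m.A.comp n.A).Elt i k),
      incComp m n p ≫ f = incComp m n p ≫ g) : f = g :=
  FamPro.hom_ext (m := m.comp n) h

/-- The comparison map from the coproduct of composites to the composite of coproducts. -/
noncomputable def sumCompHom (m : FamPro X Y) (n : FamPro Y Z) :
    (m.comp n).sum.apex ⟶ (m.sum.comp n.sum).apex :=
  descComp fun p => SpanPro.lift
    ((m.span p.fst).fst (n.span p.snd) ≫ m.inc p.fst)
    ((m.span p.fst).snd (n.span p.snd) ≫ n.inc p.snd) (by simp)

theorem incComp_sumCompHom (m : FamPro X Y) (n : FamPro Y Z) {i : X.I} {k : Z.I}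
    (p : (m.A.comp n.A).Elt i k) : incComp m n p ≫ sumCompHom m n = SpanPro.lift
      ((m.span p.fst).fst (n.span p.snd) ≫ m.inc p.fst)
      ((m.span p.fst).snd (n.span p.snd) ≫ n.inc p.snd) (by simp) := incComp_descComp _ p

theorem incComp_sumCompHom_fst (m : FamPro X Y) (n : FamPro Y Z) {i : X.I} {k : Z.I}
    (p : (m.A.comp n.A).Elt i k) : incComp m n p ≫ sumCompHom m n ≫ m.sum.fst n.sum =
      (m.span p.fst).fst (n.span p.snd) ≫ m.inc p.fst := by
  rw [← Category.assoc, incComp_sumCompHom, SpanPro.lift_fst]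

theorem incComp_sumCompHom_snd (m : FamPro X Y) (n : FamPro Y Z) {i : X.I} {k : Z.I}
    (p : (m.A.comp n.A).Elt i k) : incComp m n p ≫ sumCompHom m n ≫ m.sum.snd n.sum =
      (m.span p.fst).snd (n.span p.snd) ≫ n.inc p.snd := by
  rw [← Category.assoc, incComp_sumCompHom, SpanPro.lift_snd]

/-- The comparison cell for the composition of families of spans. -/
noncomputable def sumComp (m : FamPro X Y) (n : FamPro Y Z) :
    SpanCell (m.comp n).sum (m.sum.comp n.sum) where
  src := 𝟙 _
  tgt := 𝟙 _
  hom := sumCompHom m n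
  hom_l := comp_hom_ext fun p => by
    rw [← Category.assoc, incComp_sumCompHom]
    simp [incComp_l]
  hom_r := comp_hom_ext fun p => by
    rw [← Category.assoc, incComp_sumCompHom]
    simp [incComp_r]

/-- The comparison cell for the identity families of spans. -/
noncomputable def sumUnit (X : Fam K (SpanCat S)) :
    SpanCell (FamPro.id X).sum (SpanPro.id X.sum) where
  src := 𝟙 _
  tgt := 𝟙 _
  hom := (FamPro.id X).sum.l ≫ SpanPro.toId _
  hom_l := by simp
  hom_r := FamPro.hom_ext fun {i j} a => by
    -- The legs of an identity span agree, but `idPro` reduces to one only once the two feet of the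
    -- index have been identified.
    have key : ∀ h : i = j, SpanPro.l (FamPro.idPro X h) ≫ X.inc i =
        SpanPro.r (FamPro.idPro X h) ≫ X.inc j := by
      rintro rfl; rfl
    rw [Category.comp_id, Category.assoc, SpanPro.id_r, SpanPro.toId_l, Category.comp_id,
      FamPro.inc_l, FamPro.inc_r]
    exact key a.eq_of_id

end FamCell
end Sum

/-! ### Naturality and coherence of the comparison cells. -/

section Sum

variable {K : IndexClass.{w}} {S : Type u} [Category.{v} S] [HasPullbacks S]
variable [HasCoproductsOfClass K S]
set_option linter.unusedSectionVars false
namespace FamCell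

variable {X Y Z T X' Y' Z' X'' Y'' : Fam K (SpanCat S)}

theorem sum_tgt_eq_src {m : FamPro X Y} {n : FamPro Y Z} {m' : FamPro X' Y'}
    {n' : FamPro Y' Z'} (α : FamCell m m') (β : FamCell n n') (h : α.tgt = β.src) :
    α.sum.tgt = β.sum.src := congrArg Fam.sumMap h

theorem id_tgt_eq_sumComp_src (m : FamPro X Y) (n : FamPro Y Z) (k : FamPro Z T) :
    (SpanCell.id m.sum).tgt = (sumComp n k).src := rfl

theorem sumComp_tgt_eq_id_src (m : FamPro X Y) (n : FamPro Y Z) (k : FamPro Z T) :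
    (sumComp m n).tgt = (SpanCell.id k.sum).src := rfl

theorem sumUnit_tgt_eq_id_src (m : FamPro X Y) :
    (sumUnit X).tgt = (SpanCell.id m.sum).src := rfl

theorem id_tgt_eq_sumUnit_src (m : FamPro X Y) :
    (SpanCell.id m.sum).tgt = (sumUnit Y).src := rfl

/-- On the summand at `p`, both composites are determined by their two projections from the target
pullback; each projection applies one of the cells and then a coproduct inclusion. -/
theorem sumComp_naturality {m : FamPro X Y} {n : FamPro Y Z} {m' : FamPro X' Y'}
    {n' : FamPro Y' Z'} (α : FamCell m m') (β : FamCell n n') (h : α.tgt = β.src) :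
    (hcomp α β h).sum.comp (sumComp m' n') =
      (sumComp m n).comp (SpanCell.hcomp α.sum β.sum (sum_tgt_eq_src α β h)) := by
  refine SpanCell.ext ((Category.comp_id _).trans (Category.id_comp _).symm)
    ((Category.comp_id _).trans (Category.id_comp _).symm) (comp_hom_ext fun p => ?_)
  -- The image of `p` is generalized to any element `q` whose halves are the images of the halves of
  -- `p`, so that the components of the cells are those given by `spanCellAt`.
  have key : ∀ {i' k'} (q : (m'.A.comp n'.A).Elt i' k')
      (h1 : α.index p.fst.val = q.fst.val) (h2 : β.index p.snd.val = q.snd.val)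
      (h3 : (α.spanCellAt p.fst q.fst h1).tgt = (β.spanCellAt p.snd q.snd h2).src),
      ((SpanCell.hcomp (α.spanCellAt p.fst q.fst h1) (β.spanCellAt p.snd q.snd h2) h3).hom ≫
        incComp m' n' q) ≫ sumCompHom m' n' =
      (incComp m n p ≫ sumCompHom m n) ≫
        (SpanCell.hcomp α.sum β.sum (sum_tgt_eq_src α β h)).hom := by
    intro i' k' q h1 h2 h3
    rw [Category.assoc, incComp_sumCompHom, incComp_sumCompHom]
    apply SpanPro.comp_hom_ext
    · simp [spanCellAt_hom_inc]
    · simp [spanCellAt_hom_inc]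
  refine Eq.trans ?_ ((key ((hcomp α β h).map p) rfl rfl
    (tgt_cellAt_eq_src_cellAt α β h _ _ _ _ _ _)).trans (Category.assoc _ _ _))
  exact (Category.assoc _ _ _).symm.trans
    (congrArg (· ≫ sumCompHom m' n') (inc_sum_hom (hcomp α β h) p))

/-- The target is an identity span, so the apex map is forced: on both sides it is the left leg
followed by `Fam.sumMap f`. -/
theorem sumUnit_naturality (f : X ⟶ Y) :
    (unit f).sum.comp (sumUnit Y) = (sumUnit X).comp (SpanCell.unit (Fam.sumMap f)) :=
  SpanCell.ext ((Category.comp_id _).trans (Category.id_comp _).symm)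
    ((Category.comp_id _).trans (Category.id_comp _).symm) <| by
    simp only [SpanCell.comp_hom, sumUnit, SpanCell.unit_hom, Category.assoc, SpanCell.hom_l_assoc,
      SpanCell.toId_l_assoc]
    rfl

/-- On the summand at `p`, both sides have the same three projections: each projects the iterated
pullback of the components to one apex and then includes it in the corresponding coproduct. -/
theorem sumComp_coassociativity (m : FamPro X Y) (n : FamPro Y Z) (k : FamPro Z T) :
    (associator m n k).sum.comp ((sumComp m (n.comp k)).comp
        (SpanCell.hcomp (SpanCell.id m.sum) (sumComp n k) (id_tgt_eq_sumComp_src m n k))) =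
      (sumComp (m.comp n) k).comp
        ((SpanCell.hcomp (sumComp m n) (SpanCell.id k.sum) (sumComp_tgt_eq_id_src m n k)).comp
          (SpanCell.associator m.sum n.sum k.sum)) := by
  refine SpanCell.ext ?_ ?_ (comp_hom_ext fun p => ?_)
  · exact congrArg (· ≫ 𝟙 _ ≫ 𝟙 _) Fam.sumMap_id
  · exact congrArg (· ≫ 𝟙 _ ≫ 𝟙 _) Fam.sumMap_id
  -- The inclusions are named with their sources written as composites of the three component spans.
  -- After `clear_value` they are opaque, and the argument uses only `e` and the projection
  -- identities.
  let M := m.span p.fst.fst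
  let N := n.span p.fst.snd
  let L := k.span p.snd
  let a : (M.comp N).apex ⟶ (m.comp n).sum.apex := incComp m n p.fst
  let b : (N.comp L).apex ⟶ (n.comp k).sum.apex := incComp n k ((associator m n k).map p).snd
  let d : (M.comp (N.comp L)).apex ⟶ (m.comp (n.comp k)).sum.apex :=
    incComp m (n.comp k) ((associator m n k).map p)
  let q : ((M.comp N).comp L).apex ⟶ ((m.comp n).comp k).sum.apex := incComp (m.comp n) k p
  have e : q ≫ (associator m n k).sum.hom =
      (SpanCell.associator M N L).hom ≫ d := inc_sum_hom (associator m n k) p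
  have ha : a ≫ sumCompHom m n ≫ m.sum.fst n.sum = M.fst N ≫ m.inc p.fst.fst :=
    incComp_sumCompHom_fst m n p.fst
  have ha' : a ≫ sumCompHom m n ≫ m.sum.snd n.sum = M.snd N ≫ n.inc p.fst.snd :=
    incComp_sumCompHom_snd m n p.fst
  have hb : b ≫ sumCompHom n k ≫ n.sum.fst k.sum = N.fst L ≫ n.inc p.fst.snd :=
    incComp_sumCompHom_fst n k ((associator m n k).map p).snd
  have hb' : b ≫ sumCompHom n k ≫ n.sum.snd k.sum = N.snd L ≫ k.inc p.snd :=
    incComp_sumCompHom_snd n k ((associator m n k).map p).snd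
  have hd : d ≫ sumCompHom m (n.comp k) ≫ m.sum.fst (n.comp k).sum =
      M.fst (N.comp L) ≫ m.inc p.fst.fst :=
    incComp_sumCompHom_fst m (n.comp k) ((associator m n k).map p)
  have hd' : d ≫ sumCompHom m (n.comp k) ≫ m.sum.snd (n.comp k).sum = M.snd (N.comp L) ≫ b :=
    incComp_sumCompHom_snd m (n.comp k) ((associator m n k).map p)
  have hp : q ≫ sumCompHom (m.comp n) k ≫ (m.comp n).sum.fst k.sum =
      (M.comp N).fst L ≫ a := incComp_sumCompHom_fst (m.comp n) k p
  have hp' : q ≫ sumCompHom (m.comp n) k ≫ (m.comp n).sum.snd k.sum =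
      (M.comp N).snd L ≫ k.inc p.snd := incComp_sumCompHom_snd (m.comp n) k p
  change q ≫ _ = q ≫ _
  clear_value a b d q
  apply SpanPro.comp_hom_ext
  · simp [sumComp, reassoc_of% e, reassoc_of% hp, ha, hd]
  · apply SpanPro.comp_hom_ext
    · simp [sumComp, reassoc_of% e, reassoc_of% hp, ha', reassoc_of% hd', hb]
    · simp [sumComp, reassoc_of% e, hp', reassoc_of% hd', hb']

/-- On each summand both apex maps are the second projection, out of the composite with an identity
span, followed by a coproduct inclusion. -/
theorem sumComp_left_counitality (m : FamPro X Y) :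
    (leftUnitor m).sum = (sumComp (FamPro.id X) m).comp
      ((SpanCell.hcomp (sumUnit X) (SpanCell.id m.sum) (sumUnit_tgt_eq_id_src m)).comp
        (SpanCell.leftUnitor m.sum)) := by
  refine SpanCell.ext ?_ ?_ (comp_hom_ext fun p => ?_)
  · refine Fam.sumMap_id.trans ?_
    simp [sumComp, sumUnit]
  · refine Fam.sumMap_id.trans ?_
    simp [sumComp]
  · simp [sumComp, incComp_sumCompHom_snd]
    -- The element of `m.A` occurs with two left feet, `i₀` as a half of `p` and `i` as the image of
    -- `p` under the unitor; making both variables allows them to be identified.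
    have key : ∀ {i i₀ : X.I} {j : Y.I} (h : i = i₀) (a : m.A.Elt i₀ j)
        (b : m.A.Elt i j) (e : a.val = b.val),
        SpanCell.hom (leftUnitorAt m h a b e) ≫ m.inc b =
          SpanPro.snd (FamPro.idPro X h) (m.span a) ≫ m.inc a := by
      rintro i _ j rfl a b e
      obtain rfl := IndexSpan.Elt.ext e
      rfl
    exact (inc_sum_hom (leftUnitor m) p).trans (key _ _ _ _)

theorem sumComp_right_counitality (m : FamPro X Y) :
    (rightUnitor m).sum = (sumComp m (FamPro.id Y)).comp
      ((SpanCell.hcomp (SpanCell.id m.sum) (sumUnit Y) (id_tgt_eq_sumUnit_src m)).comp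
        (SpanCell.rightUnitor m.sum)) := by
  refine SpanCell.ext ?_ ?_ (comp_hom_ext fun p => ?_)
  · refine Fam.sumMap_id.trans ?_
    simp [sumComp]
  · refine Fam.sumMap_id.trans ?_
    simp [sumComp, sumUnit]
  · simp [sumComp, incComp_sumCompHom_fst]
    have key : ∀ {i : X.I} {j j₀ : Y.I} (h : j₀ = j) (a : m.A.Elt i j₀)
        (b : m.A.Elt i j) (e : a.val = b.val),
        SpanCell.hom (rightUnitorAt m h a b e) ≫ m.inc b =
          SpanPro.fst (m.span a) (FamPro.idPro Y h) ≫ m.inc a := by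
      rintro i j _ rfl a b e
      obtain rfl := IndexSpan.Elt.ext e
      rfl
    exact (inc_sum_hom (rightUnitor m) p).trans (key _ _ _ _)

end FamCell

variable (K S)

/-- The coproduct of families of objects and of spans, as a colax double functor. -/
noncomputable def sumFunctor : ColaxFunctor (Fam K (SpanCat S)) (SpanCat S) where
  obj X := ⟨X.sum⟩
  map f := Fam.sumMap f
  map_id _ := Fam.sumMap_id
  map_comp f g := Fam.sumMap_comp f g
  mapPro m := FamPro.sum m
  mapCell α := FamCell.sum α
  src_mapCell _ := rfl
  tgt_mapCell _ := rfl
  mapCell_id m := FamCell.sum_id m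
  mapCell_comp α β := FamCell.sum_comp α β
  compCell m n := FamCell.sumComp m n
  idCell X := FamCell.sumUnit X
  src_compCell _ _ := rfl
  tgt_compCell _ _ := rfl
  src_idCell _ := rfl
  tgt_idCell _ := rfl
  compCell_naturality α β h := FamCell.sumComp_naturality α β h
  idCell_naturality f := FamCell.sumUnit_naturality f
  coassociativity m n k := FamCell.sumComp_coassociativity m n k
  left_counitality m := FamCell.sumComp_left_counitality m
  right_counitality m := FamCell.sumComp_right_counitality m
end Sum

/-! ### The adjunction between coproducts and singleton families. -/

section Sum

variable {K : IndexClass.{w}} {S : Type u} [Category.{v} S] [HasPullbacks S]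
variable [HasCoproductsOfClass K S]
set_option linter.unusedSectionVars false

namespace SpanCell

theorem id_comp {x y x' y' : S} {m : SpanPro x y} {n : SpanPro x' y'} (α : SpanCell m n) :
    (id m).comp α = α :=
  SpanCell.ext (Category.id_comp _) (Category.id_comp _) (Category.id_comp _)

theorem comp_id {x y x' y' : S} {m : SpanPro x y} {n : SpanPro x' y'} (α : SpanCell m n) :
    α.comp (id n) = α :=
  SpanCell.ext (Category.comp_id _) (Category.comp_id _) (Category.comp_id _)

end SpanCell

namespace FamPro

variable {X Y Z : Fam K (SpanCat S)}

/-- The coproduct inclusions, as a map of spans. -/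
noncomputable def incCell (m : FamPro X Y) {i : X.I} {j : Y.I} (a : m.A.Elt i j) :
    SpanCell (m.span a) m.sum :=
  ⟨X.inc i, Y.inc j, m.inc a, inc_l m a, inc_r m a⟩

/-- This is naturality of the unit on cells, read off at one component. -/
theorem incCell_sum {X' Y' : Fam K (SpanCat S)} {m : FamPro X Y} {n : FamPro X' Y'}
    (α : FamCell m n) {i : X.I} {j : Y.I} (a : m.A.Elt i j) :
    (α.spanCell a).comp (n.incCell (α.map a)) = (m.incCell a).comp α.sum := by
  apply SpanCell.ext
  · exact ((Fam.inc_sumMap α.src i).trans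
      (congrArg (· ≫ _) (FamCell.spanCell_src α a).symm)).symm
  · exact ((Fam.inc_sumMap α.tgt j).trans
      (congrArg (· ≫ _) (FamCell.spanCell_tgt α a).symm)).symm
  · exact (FamCell.inc_sum_hom α a).symm

/-- The comparison map was defined by exactly this property on apexes; it makes the unit compatible
with external composition. -/
theorem incCell_comp (m : FamPro X Y) (n : FamPro Y Z) {i : X.I} {k : Z.I}
    (p : (m.A.comp n.A).Elt i k) :
    SpanCell.comp ((m.comp n).incCell p) (FamCell.sumComp m n) =
      SpanCell.hcomp (m.incCell p.fst) (n.incCell p.snd) rfl := by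
  apply SpanCell.ext
  · exact Category.comp_id _
  · exact Category.comp_id _
  · exact FamCell.incComp_sumCompHom m n p

theorem incCell_id (X : Fam K (SpanCat S)) (i : X.I) :
    SpanCell.comp ((FamPro.id X).incCell ⟨i, rfl, rfl⟩) (FamCell.sumUnit X) =
      SpanCell.unit (X.inc i) := by
  apply SpanCell.ext
  · exact Category.comp_id _
  · exact Category.comp_id _
  · exact (inc_l_assoc (FamPro.id X) ⟨i, rfl, rfl⟩ _)

end FamPro

variable (K S)

/-- The unit of the adjunction between coproducts and singleton families. -/
noncomputable def sumUnitTrans : ColaxFunctor.NatTrans (ColaxFunctor.id (Fam K (SpanCat S)))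
    ((sumFunctor K S).comp (delta K (SpanCat S))) where
  app X := ⟨fun _ => PUnit.unit, fun i => X.inc i⟩
  naturality X Y f := congrArg (FamHom.mk _) (funext fun i => (Fam.inc_sumMap f i).symm)
  cell {X Y} m := ⟨⟨fun _ => PUnit.unit, fun i => X.inc i⟩, ⟨fun _ => PUnit.unit, fun i => Y.inc i⟩,
    fun _ => PUnit.unit, fun _ => rfl, fun _ => rfl, fun a => FamPro.incCell m a,
    fun _ => rfl, fun _ => rfl⟩
  src_cell _ := rfl
  tgt_cell _ := rfl
  cell_naturality {X Y X' Y' m n} α := FamCell.ext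
    (congrArg (FamHom.mk _) (funext fun i => (Fam.inc_sumMap (FamCell.src α) i).symm))
    (congrArg (FamHom.mk _) (funext fun i => (Fam.inc_sumMap (FamCell.tgt α) i).symm))
    (fun _ => rfl) fun a => FamPro.incCell_sum α a
  cell_comp {X Y Z} m n := FamCell.ext
    ((congrArg (CategoryStruct.comp _) (ColaxFunctor.src_compCell _ m n)).trans
      ((Category.comp_id _).trans (Category.id_comp _).symm))
    ((congrArg (CategoryStruct.comp _) (ColaxFunctor.tgt_compCell _ m n)).trans
      ((Category.comp_id _).trans (Category.id_comp _).symm))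
    (fun _ => rfl) fun p => by
      -- The two identity cells come from the comparison cells of `delta` and of the identity
      -- functor; without them the equation is `incCell_comp`.
      have h : SpanCell.comp ((FamPro.comp m n).incCell p)
          ((FamCell.sumComp m n).comp (SpanCell.id _)) = (SpanCell.id _).comp
            (SpanCell.hcomp (FamPro.incCell m p.fst) (FamPro.incCell n p.snd) rfl) := by
        rw [SpanCell.comp_id, SpanCell.id_comp]
        exact FamPro.incCell_comp m n p
      exact h
  cell_unit X := FamCell.ext
    ((congrArg (CategoryStruct.comp _) (ColaxFunctor.src_idCell _ X)).trans
      ((Category.comp_id _).trans (Category.id_comp _).symm))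
    ((congrArg (CategoryStruct.comp _) (ColaxFunctor.tgt_idCell _ X)).trans
      ((Category.comp_id _).trans (Category.id_comp _).symm))
    (fun _ => rfl) fun {i j} a => by
      obtain ⟨a, rfl, rfl⟩ := a
      have h : SpanCell.comp ((FamPro.id X).incCell ⟨a, rfl, rfl⟩)
          ((FamCell.sumUnit X).comp (SpanCell.id _)) =
            (SpanCell.id _).comp (SpanCell.unit (X.inc a)) := by
        rw [SpanCell.comp_id, SpanCell.id_comp]
        exact FamPro.incCell_id X a
      exact h

variable {S}

/-- The singleton family of an object. -/
noncomputable abbrev Fam.single (x : SpanCat S) : Fam K (SpanCat S) := (delta K (SpanCat S)).obj x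

/-- The singleton family of a span. -/
noncomputable abbrev FamPro.single {x y : SpanCat S} (m : SpanPro x.obj y.obj) :
    FamPro (Fam.single K x) (Fam.single K y) := (delta K (SpanCat S)).mapPro m

/-- The singleton family of a map of spans. -/
noncomputable abbrev FamCell.single {x y x' y' : SpanCat S} {m : SpanPro x.obj y.obj}
    {n : SpanPro x'.obj y'.obj} (α : SpanCell m n) :
    FamCell (FamPro.single K m) (FamPro.single K n) :=
  (delta K (SpanCat S)).mapCell (x := x) (y := y) (x' := x') (y' := y') (m := m) (n := n) α

namespace Fam

noncomputable def incSingle (x : SpanCat S) : x.obj ⟶ (single K x).sum :=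
  (single K x).inc PUnit.unit

theorem single_hom_ext {x : SpanCat S} {T : S} {f g : (single K x).sum ⟶ T}
    (h : incSingle K x ≫ f = incSingle K x ≫ g) : f = g :=
  hom_ext fun _ => h

/-- The codiagonal from the coproduct of a singleton family. -/
noncomputable def fold (x : SpanCat S) : (single K x).sum ⟶ x.obj := desc fun _ => 𝟙 x.obj

@[simp] theorem incSingle_fold (x : SpanCat S) : incSingle K x ≫ fold K x = 𝟙 x.obj :=
  inc_desc (X := single K x) (fun _ => 𝟙 x.obj) PUnit.unit

@[simp] theorem incSingle_fold_assoc (x : SpanCat S) {T : S} (f : x.obj ⟶ T) :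
    incSingle K x ≫ fold K x ≫ f = f := by
  rw [← Category.assoc, incSingle_fold, Category.id_comp]

theorem fold_naturality {x y : SpanCat S} (f : x.obj ⟶ y.obj) :
    sumMap ((delta K (SpanCat S)).map (X := x) (Y := y) f) ≫ fold K y = fold K x ≫ f :=
  single_hom_ext K <| by
    have h : incSingle K x ≫ sumMap ((delta K (SpanCat S)).map (X := x) (Y := y) f) =
      f ≫ incSingle K y := inc_sumMap _ _
    rw [← Category.assoc, h]
    simp

end Fam

namespace FamPro

variable {x y z : SpanCat S}

noncomputable def incSingle (m : SpanPro x.obj y.obj) : m.apex ⟶ (single K m).sum.apex :=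
  (single K m).inc (i := PUnit.unit) (j := PUnit.unit) ⟨PUnit.unit, rfl, rfl⟩

theorem single_hom_ext {m : SpanPro x.obj y.obj} {T : S} {f g : (single K m).sum.apex ⟶ T}
    (h : incSingle K m ≫ f = incSingle K m ≫ g) : f = g :=
  hom_ext fun _ => h

theorem incSingle_l (m : SpanPro x.obj y.obj) :
    incSingle K m ≫ (single K m).sum.l = m.l ≫ Fam.incSingle K x := inc_l _ _

theorem incSingle_l_assoc (m : SpanPro x.obj y.obj) {T : S} (f : (Fam.single K x).sum ⟶ T) :
    incSingle K m ≫ (single K m).sum.l ≫ f = m.l ≫ Fam.incSingle K x ≫ f :=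
  inc_l_assoc _ _ _

theorem incSingle_r (m : SpanPro x.obj y.obj) :
    incSingle K m ≫ (single K m).sum.r = m.r ≫ Fam.incSingle K y := inc_r _ _

theorem incSingle_r_assoc (m : SpanPro x.obj y.obj) {T : S} (f : (Fam.single K y).sum ⟶ T) :
    incSingle K m ≫ (single K m).sum.r ≫ f = m.r ≫ Fam.incSingle K y ≫ f :=
  inc_r_assoc _ _ _

/-- The codiagonal from the apex of the coproduct of a singleton family of spans. -/
noncomputable def fold (m : SpanPro x.obj y.obj) : (single K m).sum.apex ⟶ m.apex :=
  desc (m := single K m) fun _ => 𝟙 m.apex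

@[simp] theorem incSingle_fold (m : SpanPro x.obj y.obj) : incSingle K m ≫ fold K m = 𝟙 m.apex :=
  inc_desc (m := single K m) (fun _ => 𝟙 m.apex) _

@[simp] theorem incSingle_fold_assoc (m : SpanPro x.obj y.obj) {T : S} (f : m.apex ⟶ T) :
    incSingle K m ≫ fold K m ≫ f = f := by
  rw [← Category.assoc, incSingle_fold, Category.id_comp]

end FamPro

namespace FamCell

variable {x y z x' y' : SpanCat S}

/-- The codiagonal from the coproduct of a singleton family of spans. -/
@[simps] noncomputable def fold (m : SpanPro x.obj y.obj) : SpanCell (FamPro.single K m).sum m where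
  src := Fam.fold K x
  tgt := Fam.fold K y
  hom := FamPro.fold K m
  hom_l := FamPro.single_hom_ext K <| by
    rw [FamPro.incSingle_l_assoc]
    simp
  hom_r := FamPro.single_hom_ext K <| by
    rw [FamPro.incSingle_r_assoc]
    simp

theorem fold_naturality {m : SpanPro x.obj y.obj}
    {n : SpanPro x'.obj y'.obj} (α : SpanCell m n) :
    (single K α).sum.comp (fold K n) = (fold K m).comp α := by
  refine SpanCell.ext (Fam.fold_naturality K (x := x) (y := x') α.src)
    (Fam.fold_naturality K (x := y) (y := y') α.tgt) (FamPro.single_hom_ext K ?_)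
  have h : FamPro.incSingle K m ≫ (single K α).sum.hom = α.hom ≫ FamPro.incSingle K n :=
    inc_sum_hom (single K α) _
  rw [SpanCell.comp_hom, SpanCell.comp_hom, ← Category.assoc, h]
  simp

theorem fold_tgt_eq_fold_src (m : SpanPro x.obj y.obj) (n : SpanPro y.obj z.obj) :
    (fold K m).tgt = (fold K n).src := rfl

/-- This is the apex part of compatibility of the counit with external composition. On the only
summand, the comparison pairs the two singleton inclusions, and the codiagonals undo them
coordinatewise. -/
theorem incSingle_comp_hom (m : SpanPro x.obj y.obj) (n : SpanPro y.obj z.obj) :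
    FamPro.incSingle K (m.comp n) ≫
        (((delta K (SpanCat S)).comp (sumFunctor K S)).compCell (x := x) (y := y) (z := z)
          m n).hom ≫
        (SpanCell.hcomp (fold K m) (fold K n) (fold_tgt_eq_fold_src K m n)).hom = 𝟙 _ := by
  let q : (m.comp n).apex ⟶ ((FamPro.single K m).comp (FamPro.single K n)).sum.apex :=
    incComp (FamPro.single K m) (FamPro.single K n) (i := PUnit.unit) (k := PUnit.unit)
      ⟨⟨(PUnit.unit, PUnit.unit), rfl⟩, rfl, rfl⟩
  let e : FamCell (FamPro.single K (m.comp n)) ((FamPro.single K m).comp (FamPro.single K n)) :=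
    (delta K (SpanCat S)).compCell (x := x) (y := y) (z := z) m n
  have h1 : FamPro.incSingle K (m.comp n) ≫ e.sum.hom = q :=
    (inc_sum_hom e _).trans (Category.id_comp _)
  have h2 : q ≫ sumCompHom (FamPro.single K m) (FamPro.single K n) =
      SpanPro.lift (m.fst n ≫ FamPro.incSingle K m) (m.snd n ≫ FamPro.incSingle K n)
        (by simp [FamPro.incSingle_l, FamPro.incSingle_r]) := incComp_sumCompHom _ _ _
  -- The comparison of the composite functor unfolds to the coproduct of the comparison of `delta`,
  -- followed by the comparison of coproducts.
  change FamPro.incSingle K (m.comp n) ≫ (e.sum.hom ≫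
    sumCompHom (FamPro.single K m) (FamPro.single K n)) ≫ _ = _
  rw [← Category.assoc, ← Category.assoc, h1, h2]
  apply SpanPro.comp_hom_ext <;> simp

end FamCell

/-- Maps of spans to an identity span are determined by their boundary arrows. -/
theorem SpanCell.ext_of_id {x y z : S} {m : SpanPro x y} {α β : SpanCell m (SpanPro.id z)}
    (hs : α.src = β.src) (ht : α.tgt = β.tgt) : α = β := by
  have h : ∀ γ : SpanCell m (SpanPro.id z), γ.hom = m.l ≫ γ.src ≫ SpanPro.toId z := fun γ => by
    rw [← γ.hom_l_assoc, SpanPro.l_toId, Category.comp_id]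
  exact SpanCell.ext hs ht (by rw [h, h, hs])

variable (S)

/-- The counit of the adjunction between coproducts and singleton families. -/
noncomputable def sumCounitTrans : ColaxFunctor.NatTrans
    ((delta K (SpanCat S)).comp (sumFunctor K S)) (ColaxFunctor.id (SpanCat S)) where
  app x := Fam.fold K x
  naturality x y f := Fam.fold_naturality K (x := x) (y := y) f
  cell {x y} m := FamCell.fold K (x := x) (y := y) m
  src_cell _ := rfl
  tgt_cell _ := rfl
  cell_naturality {x y x' y' m n} α :=
    FamCell.fold_naturality K (x := x) (y := y) (x' := x') (y' := y') (m := m) (n := n) α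
  cell_comp {x y z} m n := by
    refine SpanCell.ext ?_ ?_ (FamPro.single_hom_ext K ?_)
    · exact (Category.comp_id _).trans ((congrArg (· ≫ _) (ColaxFunctor.src_compCell
        ((delta K (SpanCat S)).comp (sumFunctor K S)) m n)).trans (Category.id_comp _)).symm
    · exact (Category.comp_id _).trans ((congrArg (· ≫ _) (ColaxFunctor.tgt_compCell
        ((delta K (SpanCat S)).comp (sumFunctor K S)) m n)).trans (Category.id_comp _)).symm
    · have h : FamPro.incSingle K (SpanPro.comp m n) ≫ FamPro.fold K (SpanPro.comp m n) ≫ 𝟙 _ =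
        𝟙 _ := by simp
      exact h.trans (FamCell.incSingle_comp_hom K (x := x) (y := y) (z := z) m n).symm
  cell_unit x := SpanCell.ext_of_id
    ((Category.comp_id _).trans ((congrArg (· ≫ _) (ColaxFunctor.src_idCell
        ((delta K (SpanCat S)).comp (sumFunctor K S)) x)).trans (Category.id_comp _)).symm)
    ((Category.comp_id _).trans ((congrArg (· ≫ _) (ColaxFunctor.tgt_idCell
        ((delta K (SpanCat S)).comp (sumFunctor K S)) x)).trans (Category.id_comp _)).symm)

/-- The left triangle on objects, which also supplies the boundary arrows of the left triangle on
spans. The unit sends the summand at `i` into a singleton coproduct, whose inclusion the codiagonal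
cancels. -/
theorem sumMap_unit_fold (X : Fam K (SpanCat S)) :
    Fam.sumMap ((sumUnitTrans K S).app X) ≫ Fam.fold K ⟨X.sum⟩ = 𝟙 X.sum :=
  Fam.hom_ext fun i => by
    have h : X.inc i ≫ Fam.sumMap ((sumUnitTrans K S).app X) =
      X.inc i ≫ Fam.incSingle K ⟨X.sum⟩ := Fam.inc_sumMap _ _
    refine (Category.assoc _ _ _).symm.trans ((congrArg (· ≫ _) h).trans ?_)
    exact (Category.assoc _ _ _).trans
      (congrArg (CategoryStruct.comp _) (Fam.incSingle_fold K _))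

/-- The adjunction between coproducts and singleton families. -/
noncomputable def sumAdjunction :
    ColaxFunctor.Adjunction (sumFunctor K S) (delta K (SpanCat S)) where
  unit := sumUnitTrans K S
  counit := sumCounitTrans K S
  left_triangle X := sumMap_unit_fold K S X
  right_triangle y := congrArg (FamHom.mk _) (funext fun _ => Fam.incSingle_fold K y)
  left_triangle_cell {X Y} m := by
    refine SpanCell.ext (sumMap_unit_fold K S X) (sumMap_unit_fold K S Y)
      (FamPro.hom_ext fun a => ?_)
    have h : FamPro.inc m a ≫ (FamCell.sum ((sumUnitTrans K S).cell m)).hom =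
      FamPro.inc m a ≫ FamPro.incSingle K (x := ⟨X.sum⟩) (y := ⟨Y.sum⟩) (FamPro.sum m) :=
      FamCell.inc_sum_hom _ _
    refine (Category.assoc _ _ _).symm.trans ((congrArg (· ≫ _) h).trans ?_)
    exact (Category.assoc _ _ _).trans
      (congrArg (CategoryStruct.comp _) (FamPro.incSingle_fold K _))
  right_triangle_cell {x y} m := FamCell.ext
    (congrArg (FamHom.mk _) (funext fun _ => Fam.incSingle_fold K x))
    (congrArg (FamHom.mk _) (funext fun _ => Fam.incSingle_fold K y)) (fun _ => rfl) fun _ =>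
      SpanCell.ext (Fam.incSingle_fold K x) (Fam.incSingle_fold K y) (FamPro.incSingle_fold K m)

theorem hasColaxCoproductsOf_spanCat : HasColaxCoproductsOf K (SpanCat S) :=
  ⟨sumFunctor K S, ⟨sumAdjunction K S⟩⟩

end Sum

/-! ### Universality and disjointness of van Kampen coproducts. -/

/-- The category `S` has van Kampen coproducts of families indexed by the sets in the class `K`,
which contains the empty set. -/
class ExtensiveOfClass (K : IndexClass.{w}) (S : Type u) [Category.{v} S] : Prop
    extends HasCoproductsOfClass K S where
  mem_pempty : K.mem PEmpty
  vanKampen : ∀ {ι : Type w}, K.mem ι → ∀ (X : ι → S) (c : Cofan X), IsColimit c →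
    IsVanKampenColimit c

namespace sigma

variable {K : IndexClass.{w}} {S : Type u} [Category.{v} S] [ExtensiveOfClass K S]
  {ι : Type w} {h : K.mem ι} {X : ι → S}

theorem isVanKampen (h : K.mem ι) (X : ι → S) :
    IsVanKampenColimit (Cofan.mk (sigma h X) (inj h X)) :=
  ExtensiveOfClass.vanKampen h X _ (isColimit h X)

/-- This is the universality half of the van Kampen property, for the pullbacks of `f` along the
inclusions; over a discrete shape every transformation is equifibered. -/
theorem nonempty_isColimit_pullback [HasPullbacks S] {P : S} (f : P ⟶ sigma h X) :
    Nonempty (IsColimit (Cofan.mk P fun i => pullback.fst f (inj h X i))) :=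
  (isVanKampen h X).isUniversal _ (Discrete.natTrans fun i => pullback.snd f (inj h X i.as)) f
    (by ext ⟨i⟩; exact pullback.condition.symm) (.of_discrete _)
    fun ⟨i⟩ => IsPullback.of_hasPullback f (inj h X i)

/-- Maps out of an object over a coproduct are determined by their restrictions along the pullbacks
of the coproduct inclusions. -/
theorem pullback_hom_ext [HasPullbacks S] {P : S} (f : P ⟶ sigma h X) {T : S} {a b : P ⟶ T}
    (H : ∀ i, pullback.fst f (inj h X i) ≫ a = pullback.fst f (inj h X i) ≫ b) : a = b :=
  Cofan.IsColimit.hom_ext (nonempty_isColimit_pullback f).some _ _ H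

/-- The gluing counterpart of `pullback_hom_ext`: the pieces of `P` form a coproduct cofan, so maps
on them assemble without any compatibility condition. -/
theorem exists_pullback_desc [HasPullbacks S] {P : S} (f : P ⟶ sigma h X) {T : S}
    (a : ∀ i, pullback f (inj h X i) ⟶ T) :
    ∃ b : P ⟶ T, ∀ i, pullback.fst f (inj h X i) ≫ b = a i :=
  ⟨Cofan.IsColimit.desc (nonempty_isColimit_pullback f).some a,
    fun i => Cofan.IsColimit.fac (nonempty_isColimit_pullback f).some a i⟩

/-- The coproduct of the empty family is initial. -/
noncomputable def isInitial (h : K.mem PEmpty) (X : PEmpty → S) : IsInitial (sigma h X) :=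
  IsInitial.ofUniqueHom (fun _ => desc fun i => i.elim) fun _ _ => hom_ext fun i => i.elim

/-- The empty set in the class provides the initial object on which the facts about monic inclusions
and disjointness rely. -/
theorem hasInitial (K : IndexClass.{w}) (S : Type u) [Category.{v} S] [ExtensiveOfClass K S] :
    HasInitial S :=
  (isInitial (ExtensiveOfClass.mem_pempty S) (K := K) (S := S) fun i => i.elim).hasInitial

theorem mono_inj (h : K.mem ι) (X : ι → S) (i : ι) : Mono (inj h X i) :=
  have := hasInitial K S
  mono_of_cofan_isVanKampen (isVanKampen h X) ⟨i⟩

/-- An object with equal maps to two distinct summands is initial. -/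
theorem nonempty_isInitial_of_ne [HasPullbacks S] {i j : ι} (hij : i ≠ j) {T : S} {a : T ⟶ X i} {b : T ⟶ X j}
    (hab : a ≫ inj h X i = b ≫ inj h X j) : Nonempty (IsInitial T) := by
  have := hasInitial K S
  -- Disjointness: distinct inclusions have the initial object as pullback, so `T` maps to it.
  have hp := isPullback_initial_to_of_cofan_isVanKampen (isVanKampen h X) ⟨i⟩ ⟨j⟩
    (fun e => hij (congrArg Discrete.as e))
  let f : T ⟶ ⊥_ S := hp.lift a b hab
  -- A map to an empty coproduct exhibits `T`, by universality, as a coproduct of an empty family of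
  -- pullbacks. Hence `T` is itself initial.
  let g : T ⟶ sigma (ExtensiveOfClass.mem_pempty S (K := K)) (fun i => i.elim) :=
    f ≫ initial.to _
  exact ⟨IsInitial.ofUniqueHom
    (fun Z => (exists_pullback_desc g (T := Z) fun i => i.elim).choose)
    fun _ _ => pullback_hom_ext g fun i => i.elim⟩

end sigma

/-! ### Invertibility of the comparison cells in the extensive case. -/

section Sum

variable {K : IndexClass.{w}} {S : Type u} [Category.{v} S] [HasPullbacks S]
variable [ExtensiveOfClass K S]

namespace FamCell

variable {X Y Z : Fam K (SpanCat S)}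

theorem mono_inc (m : FamPro X Y) {i : X.I} {j : Y.I} (a : m.A.Elt i j) : Mono (m.inc a) := by
  obtain ⟨a, rfl, rfl⟩ := a
  exact sigma.mono_inj m.A.mem _ _

/-- Each projection of the composite is a projection of the component pullback followed by a
coproduct inclusion. Inclusions are monic here, and the projections of a pullback are jointly monic.
-/
theorem incComp_sumCompHom_cancel (m : FamPro X Y) (n : FamPro Y Z) {i : X.I} {k : Z.I}
    (q : (m.A.comp n.A).Elt i k) {T : S} {u v : T ⟶ ((m.span q.fst).comp (n.span q.snd)).apex}
    (h : u ≫ incComp m n q ≫ sumCompHom m n = v ≫ incComp m n q ≫ sumCompHom m n) : u = v := by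
  have := mono_inc m q.fst
  have := mono_inc n q.snd
  apply SpanPro.comp_hom_ext
  · rw [← cancel_mono (m.inc q.fst), Category.assoc, Category.assoc, ← incComp_sumCompHom_fst]
    simpa using congrArg (· ≫ m.sum.fst n.sum) h
  · rw [← cancel_mono (n.inc q.snd), Category.assoc, Category.assoc, ← incComp_sumCompHom_snd]
    simpa using congrArg (· ≫ m.sum.snd n.sum) h

/-- A map to the composite of coproducts that factors through two components lifts along the
comparison map, compatibly with the coproduct inclusions. -/
theorem exists_comp_sumCompHom_eq (m : FamPro X Y) (n : FamPro Y Z) (a : m.A.apex) (b : n.A.apex)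
    {P : S} (s : P ⟶ (m.sum.comp n.sum).apex) (t : P ⟶ (m.span ⟨a, rfl, rfl⟩).apex)
    (t' : P ⟶ (n.span ⟨b, rfl, rfl⟩).apex)
    (ht : s ≫ m.sum.fst n.sum = t ≫ m.inc ⟨a, rfl, rfl⟩)
    (ht' : s ≫ m.sum.snd n.sum = t' ≫ n.inc ⟨b, rfl, rfl⟩) :
    ∃ f : P ⟶ (m.comp n).sum.apex, f ≫ sumCompHom m n = s ∧
      ∀ {i : X.I} {k : Z.I} (q : (m.A.comp n.A).Elt i k), q.val.1 = (a, b) →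
        ∀ {T : S} (u : T ⟶ P) (v : T ⟶ ((m.span q.fst).comp (n.span q.snd)).apex),
          u ≫ s = v ≫ incComp m n q ≫ sumCompHom m n → u ≫ f = v ≫ incComp m n q := by
  -- The pullback condition on `s` compares a map through the summand of `Y` where `a` ends with a
  -- map through the summand where `b` starts.
  have e : (t ≫ (m.span ⟨a, rfl, rfl⟩).r) ≫ Y.inc (m.A.r a) =
      (t' ≫ (n.span ⟨b, rfl, rfl⟩).l) ≫ Y.inc (n.A.l b) := by
    have := s ≫= m.sum.condition n.sum
    rw [reassoc_of% ht, reassoc_of% ht'] at this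
    simpa using this
  by_cases hj : m.A.r a = n.A.l b
  -- When the summands coincide, `b` is read as starting at the right foot of `a`, so that the pair
  -- `(a, b)` becomes an element of the composite; the factorization through `b` is transported
  -- accordingly.
  · obtain ⟨r, hr⟩ : ∃ r : P ⟶ (n.span ⟨b, hj.symm, rfl⟩).apex,
        s ≫ m.sum.snd n.sum = r ≫ n.inc ⟨b, hj.symm, rfl⟩ := by
      have key : ∀ {j : Y.I} (hb : n.A.l b = j), ∃ r : P ⟶ (n.span ⟨b, hb, rfl⟩).apex,
          s ≫ m.sum.snd n.sum = r ≫ n.inc ⟨b, hb, rfl⟩ := by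
        rintro _ rfl
        exact ⟨t', ht'⟩
      exact key hj.symm
    let q : (m.A.comp n.A).Elt (m.A.l a) (n.A.r b) := ⟨⟨(a, b), hj⟩, rfl, rfl⟩
    obtain ⟨f, hf⟩ : ∃ f : P ⟶ ((m.span q.fst).comp (n.span q.snd)).apex,
        f ≫ incComp m n q ≫ sumCompHom m n = s := by
      -- Monicity of the middle inclusion turns agreement in the coproduct into agreement in the
      -- summand, which is what a map to the component pullback requires.
      have hm := sigma.mono_inj Y.mem (fun j => (Y.obj j).obj) q.mid
      have hc : t ≫ (m.span q.fst).r = r ≫ (n.span q.snd).l := by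
        have := s ≫= m.sum.condition n.sum
        rw [reassoc_of% ht, reassoc_of% hr, FamPro.inc_r, FamPro.inc_l, ← Category.assoc,
          ← Category.assoc] at this
        exact hm.right_cancellation _ _ this
      refine ⟨SpanPro.lift t r hc, SpanPro.comp_hom_ext ?_ ?_⟩
      · rw [Category.assoc, Category.assoc, incComp_sumCompHom_fst, ht]
        exact SpanPro.lift_fst_assoc t r hc _
      · rw [Category.assoc, Category.assoc, incComp_sumCompHom_snd, hr]
        exact SpanPro.lift_snd_assoc t r hc _
    refine ⟨f ≫ incComp m n q, by rw [Category.assoc, hf], fun {i k} q' hq' => ?_⟩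
    obtain ⟨⟨⟨x, y⟩, hxy⟩, rfl, rfl⟩ := q'
    obtain ⟨rfl, rfl⟩ := Prod.mk.inj hq'
    intro T u v h
    rw [← hf, ← Category.assoc] at h
    rw [← Category.assoc]
    exact congrArg (· ≫ incComp m n q) (incComp_sumCompHom_cancel m n q h)
  -- When the summands differ, `P` is initial and any required equality of maps out of it holds. The
  -- final clause is vacuous, since an element over `(a, b)` would make the summands coincide.
  · obtain ⟨hP⟩ := sigma.nonempty_isInitial_of_ne (h := Y.mem) (X := fun j => (Y.obj j).obj) hj e
    refine ⟨hP.to _, hP.hom_ext _ _, fun q hq => absurd ?_ hj⟩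
    have := q.val.2
    rwa [hq] at this

/-- The target is cut into pieces indexed by all pairs `(a, b)`, by pulling back first along the
inclusions for `m` and then along those for `n`. The partial lifts on the pieces glue to the inverse
`k`. -/
theorem isIso_sumCompHom (m : FamPro X Y) (n : FamPro Y Z) : IsIso (sumCompHom m n) := by
  let P := (m.sum.comp n.sum).apex
  let iA := sigma.inj m.A.mem fun a => (m.span ⟨a, rfl, rfl⟩).apex
  let iB := sigma.inj n.A.mem fun b => (n.span ⟨b, rfl, rfl⟩).apex
  let p (a : m.A.apex) : pullback (m.sum.fst n.sum) (iA a) ⟶ P := pullback.fst _ _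
  let p' (a : m.A.apex) (b : n.A.apex) :
    pullback (p a ≫ m.sum.snd n.sum) (iB b) ⟶ pullback (m.sum.fst n.sum) (iA a) := pullback.fst _ _
  -- Universality applied twice: maps out of `P` are tested on the pieces.
  have ext {T : S} {f g : P ⟶ T} (h : ∀ a b, p' a b ≫ p a ≫ f = p' a b ≫ p a ≫ g) : f = g :=
    sigma.pullback_hom_ext (h := m.A.mem) (m.sum.fst n.sum) fun a =>
      sigma.pullback_hom_ext (h := n.A.mem) (p a ≫ m.sum.snd n.sum) (h a)
  have hf (a : m.A.apex) (b : n.A.apex) := exists_comp_sumCompHom_eq m n a b (p' a b ≫ p a)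
    (p' a b ≫ pullback.snd _ _) (pullback.snd _ _)
    (by rw [Category.assoc, Category.assoc]; exact congrArg _ pullback.condition)
    (by rw [Category.assoc]; exact pullback.condition)
  choose f hf hf' using hf
  -- The lifts are glued over `b` for fixed `a`, and then over `a`.
  have hg (a : m.A.apex) : ∃ g : pullback (m.sum.fst n.sum) (iA a) ⟶ (m.comp n).sum.apex,
      ∀ b, p' a b ≫ g = f a b :=
    sigma.exists_pullback_desc (h := n.A.mem) (p a ≫ m.sum.snd n.sum) (f a)
  choose g hg using hg
  obtain ⟨k, hk⟩ : ∃ k : P ⟶ (m.comp n).sum.apex, ∀ a, p a ≫ k = g a :=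
    sigma.exists_pullback_desc (h := m.A.mem) (m.sum.fst n.sum) g
  refine ⟨k, comp_hom_ext fun {i j} q => ?_, ext fun a b => ?_⟩
  · obtain ⟨⟨⟨a, b⟩, h⟩, rfl, rfl⟩ := q
    let q : (m.A.comp n.A).Elt (m.A.l a) (n.A.r b) := ⟨⟨(a, b), h⟩, rfl, rfl⟩
    -- The comparison map restricted to the summand at `q` factors through the piece at `(a, b)`,
    -- where `k` is given by `f a b`; the compatibility clause `hf'` then identifies the result with
    -- the inclusion at `q`.
    have key : ∃ u : ((m.span q.fst).comp (n.span q.snd)).apex ⟶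
        pullback (p a ≫ m.sum.snd n.sum) (iB b),
        u ≫ p' a b ≫ p a = incComp m n q ≫ sumCompHom m n := by
      -- The inclusion at `b`, read as starting at the right foot of `a`, differs from `iB b` only
      -- by an identification of sources.
      have hb : ∀ {j : Y.I} (hb : n.A.l b = j), ∃ e : (n.span ⟨b, hb, rfl⟩).apex ⟶ _,
        n.inc ⟨b, hb, rfl⟩ = e ≫ iB b := by
        rintro _ rfl
        exact ⟨𝟙 _, (Category.id_comp _).symm⟩
      obtain ⟨e, he⟩ := hb h.symm
      let u₁ : ((m.span q.fst).comp (n.span q.snd)).apex ⟶ pullback (m.sum.fst n.sum) (iA a) :=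
        pullback.lift (incComp m n q ≫ sumCompHom m n) ((m.span q.fst).fst (n.span q.snd))
          (by rw [Category.assoc, incComp_sumCompHom_fst]; rfl)
      have hu₁ : u₁ ≫ p a = incComp m n q ≫ sumCompHom m n := pullback.lift_fst _ _ _
      refine ⟨pullback.lift u₁ ((m.span q.fst).snd (n.span q.snd) ≫ e) ?_, ?_⟩
      · rw [reassoc_of% hu₁, incComp_sumCompHom_snd]
        exact (congrArg _ he).trans (Category.assoc _ _ _).symm
      · exact (Category.assoc _ _ _).symm.trans
          ((congrArg (· ≫ p a) (pullback.lift_fst _ _ _)).trans hu₁)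
    obtain ⟨u, hu⟩ := key
    have h1 := hf' a b q rfl u (𝟙 _) (hu.trans (Category.id_comp _).symm)
    rw [Category.id_comp, ← hg, ← hk, reassoc_of% hu] at h1
    rw [Category.comp_id]
    exact h1
  · rw [reassoc_of% hk, reassoc_of% hg, hf, Category.comp_id]

/-- The coproduct inclusions into the apex of the coproduct of identity spans. -/
noncomputable def incId (X : Fam K (SpanCat S)) (i : X.I) :
    (SpanPro.id (X.obj i).obj).apex ⟶ (FamPro.id X).sum.apex :=
  (FamPro.id X).inc (i := i) (j := i) ⟨i, rfl, rfl⟩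

theorem incId_l (X : Fam K (SpanCat S)) (i : X.I) :
    incId X i ≫ (FamPro.id X).sum.l = (SpanPro.id (X.obj i).obj).l ≫ X.inc i :=
  FamPro.inc_l _ _

/-- An element of the identity indexing span has equal feet, so the diagonal inclusions suffice as
tests. -/
theorem id_hom_ext {X : Fam K (SpanCat S)} {T : S} {f g : (FamPro.id X).sum.apex ⟶ T}
    (h : ∀ i, incId X i ≫ f = incId X i ≫ g) : f = g :=
  FamPro.hom_ext fun {_ _} a => by
    obtain ⟨i, rfl, rfl⟩ := a
    exact h i

/-- The inverse of the comparison map for identity spans. -/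
noncomputable def sumUnitInv (X : Fam K (SpanCat S)) : X.sum ⟶ (FamPro.id X).sum.apex :=
  Fam.desc fun i => SpanPro.toId _ ≫ incId X i

theorem l_sumUnitInv (X : Fam K (SpanCat S)) : (FamPro.id X).sum.l ≫ sumUnitInv X = 𝟙 _ :=
  id_hom_ext fun i => by
    rw [← Category.assoc, incId_l, Category.assoc, sumUnitInv, Fam.inc_desc, Category.comp_id,
      ← Category.assoc, SpanPro.l_toId, Category.id_comp]

theorem sumUnitInv_l (X : Fam K (SpanCat S)) : sumUnitInv X ≫ (FamPro.id X).sum.l = 𝟙 _ :=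
  Fam.hom_ext fun i => by
    rw [sumUnitInv, Fam.inc_desc_assoc, Category.assoc, incId_l, Category.comp_id,
      SpanCell.toId_l_assoc]

end FamCell

variable (K S)

theorem hasStrongCoproductsOf_spanCat : HasStrongCoproductsOf K (SpanCat S) := by
  refine ⟨sumFunctor K S, ⟨fun m n => ?_, fun X => ?_⟩, ⟨sumAdjunction K S⟩⟩
  · have := FamCell.isIso_sumCompHom m n
    exact SpanCell.isInvertible (FamCell.sumComp m n) rfl rfl (inv (FamCell.sumCompHom m n))
      (IsIso.hom_inv_id (FamCell.sumCompHom m n)) (IsIso.inv_hom_id (FamCell.sumCompHom m n))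
  -- The apex of the identity span is the coproduct itself, and its leg serves to pass from that
  -- apex to the source of `sumUnitInv`.
  · refine SpanCell.isInvertible (FamCell.sumUnit X) rfl rfl
      ((SpanPro.id X.sum).l ≫ FamCell.sumUnitInv X) ?_ ?_
    · change ((FamPro.id X).sum.l ≫ _) ≫ _ = _
      rw [Category.assoc, SpanCell.toId_l_assoc, FamCell.l_sumUnitInv]
    · change _ ≫ ((FamPro.id X).sum.l ≫ _) = _
      rw [Category.assoc, ← Category.assoc (FamCell.sumUnitInv X), FamCell.sumUnitInv_l,
        Category.id_comp, SpanPro.l_toId]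

end Sum

/-! ### Extensivity of sets and of finite sets. -/

/-- The category of types is infinitary extensive. -/
theorem infinitaryExtensive_type : InfinitaryExtensive.{u} (Type u) where
  hasCoproducts := inferInstance
  vanKampen {ι} X c hc F' c' α f hf _ := by
    let G : ι → Type u := F'.obj ∘ Discrete.mk
    -- A functor on a discrete category is determined by its values, so the upper diagram may be
    -- taken to be a family.
    have : F' = Discrete.functor G :=
      Functor.hext (fun i => rfl) (by rintro ⟨i⟩ ⟨j⟩ ⟨⟨rfl : i = j⟩⟩; simp [G])
    clear_value G
    subst this
    have hc₂ := (Cofan.nonempty_isColimit_iff_bijective_fromSigma c).1 ⟨hc⟩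
    let c₂ : Cofan G := c'
    have w (i : ι) (x : G i) : f (c₂.inj i x) = c.inj i (α.app ⟨i⟩ x) :=
      (ConcreteCategory.congr_hom (NatTrans.congr_app hf ⟨i⟩) x).symm
    have inj {i j : ι} {x : X i} {y : X j} (h : c.inj i x = c.inj j y) :
        (⟨i, x⟩ : Σ i, X i) = ⟨j, y⟩ := hc₂.1 h
    have hc' : Nonempty (IsColimit c') ↔ Function.Bijective c₂.cofanTypes.fromSigma :=
      Cofan.nonempty_isColimit_iff_bijective_fromSigma c₂
    -- For types, a commutative square is a pullback when the two projections are jointly injective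
    -- and every compatible pair is attained.
    have hp : (∀ j, IsPullback (c'.ι.app j) (α.app j) f (c.ι.app j)) ↔ ∀ i,
        (∀ x y : G i, c₂.inj i x = c₂.inj i y ∧ α.app ⟨i⟩ x = α.app ⟨i⟩ y → x = y) ∧
        ∀ (z : c₂.pt) (y : X i), f z = c.inj i y → ∃ x : G i, c₂.inj i x = z ∧ α.app ⟨i⟩ x = y :=
      ⟨fun h i => ((Types.isPullback_iff _ _ _ _).1 (h ⟨i⟩)).2,
        fun h ⟨i⟩ => (Types.isPullback_iff _ _ _ _).2 ⟨(NatTrans.congr_app hf ⟨i⟩).symm, h i⟩⟩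
    rw [hc', hp]
    constructor
    -- An element `z` lies in some summand `j`. If its image lies in the summand `i` below,
    -- disjointness of the lower coproduct forces `j = i`.
    · intro hb i
      have inj' {i j : ι} {x : G i} {y : G j} (h : c₂.inj i x = c₂.inj j y) :
        (⟨i, x⟩ : Σ i, G i) = ⟨j, y⟩ := hb.1 h
      refine ⟨fun x y h => eq_of_heq (Sigma.mk.inj (inj' h.1)).2, fun z y hz => ?_⟩
      obtain ⟨⟨j, x⟩, rfl⟩ := hb.2 z
      have h1 := inj ((w j x).symm.trans hz)
      obtain rfl : j = i := (Sigma.mk.inj h1).1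
      exact ⟨x, rfl, eq_of_heq (Sigma.mk.inj h1).2⟩
    -- Conversely, the lower coproduct determines the summand of an element of the upper cocone, and
    -- the pullback property for that summand gives a unique preimage there.
    · intro hb
      constructor
      · rintro ⟨i, x⟩ ⟨j, y⟩ h
        have h' : c₂.inj i x = c₂.inj j y := h
        have h1 := inj ((w i x).symm.trans ((congrArg f h').trans (w j y)))
        obtain rfl : i = j := (Sigma.mk.inj h1).1
        rw [(hb i).1 x y ⟨h', eq_of_heq (Sigma.mk.inj h1).2⟩]
      · intro z
        obtain ⟨⟨i, y⟩, hy⟩ := hc₂.2 (f z)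
        obtain ⟨x, hx, -⟩ := (hb i).2 z y hy.symm
        exact ⟨⟨i, x⟩, hx⟩

/-- The category of finite types is finitary extensive. -/
theorem finitaryExtensive_fintypeCat : FinitaryExtensive FintypeCat.{u} :=
  -- The inclusion in types preserves pullbacks and binary coproducts and reflects isomorphisms, so
  -- extensivity descends along it.
  finitaryExtensive_of_preserves_and_reflects_isomorphism FintypeCat.incl.{u}

/-! ### Specialization to all index sets and to finite ones. -/

section

variable {S : Type u} [Category.{v} S]

theorem HasCoproductsOfClass.of_all (h : HasCoproducts.{w} S) :
    HasCoproductsOfClass IndexClass.all.{w} S :=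
  ⟨fun ι _ => h ι⟩

theorem HasCoproductsOfClass.of_finite [HasFiniteCoproducts S] :
    HasCoproductsOfClass IndexClass.finite.{w} S :=
  ⟨fun ι (_ : Finite ι) => inferInstance⟩

theorem ExtensiveOfClass.of_infinitaryExtensive [HasPullbacks S] (h : InfinitaryExtensive.{w} S) :
    ExtensiveOfClass IndexClass.all.{w} S where
  toHasCoproductsOfClass := .of_all h.hasCoproducts
  mem_pempty := trivial
  vanKampen _ X c hc := h.vanKampen X c hc

theorem ExtensiveOfClass.of_finitaryExtensive [FinitaryExtensive S] :
    ExtensiveOfClass IndexClass.finite.{w} S where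
  toHasCoproductsOfClass := .of_finite
  mem_pempty := inferInstanceAs (Finite PEmpty)
  vanKampen {ι} (_ : Finite ι) _ _ hc := FinitaryExtensive.isVanKampen_finiteCoproducts hc

theorem hasStrongCoproducts_spanCat [HasPullbacks S] (h : InfinitaryExtensive.{w} S) :
    HasStrongCoproducts.{w} (SpanCat S) :=
  have := ExtensiveOfClass.of_infinitaryExtensive h
  hasStrongCoproductsOf_spanCat _ S

theorem hasStrongFiniteCoproducts_spanCat [HasPullbacks S] [FinitaryExtensive S] :
    HasStrongFiniteCoproducts.{w} (SpanCat S) :=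
  have := ExtensiveOfClass.of_finitaryExtensive (S := S)
  hasStrongCoproductsOf_spanCat _ S

end

end Dbl

/-- Coproducts of spans.  Let `S` be a category with pullbacks.  If `S` has (finite) coproducts, then
the double category of spans in `S` has colax (finite) coproducts.  If `S` is infinitary (finitary)
extensive, then the double category of spans in `S` has strong (finite) coproducts.  In particular
spans of sets have strong coproducts and spans of finite sets have strong finite coproducts. -/
theorem mainTheorem3 :
    (∀ (S : Type u) [Category.{v} S] [HasPullbacks S],
      (HasCoproducts.{w} S → Dbl.HasColaxCoproducts.{w} (Dbl.SpanCat S)) ∧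
      (HasFiniteCoproducts S → Dbl.HasColaxFiniteCoproducts.{w} (Dbl.SpanCat S)) ∧
      (Dbl.InfinitaryExtensive.{w} S → Dbl.HasStrongCoproducts.{w} (Dbl.SpanCat S)) ∧
      (FinitaryExtensive S → Dbl.HasStrongFiniteCoproducts.{w} (Dbl.SpanCat S))) ∧
    Dbl.HasStrongCoproducts.{u₁} (Dbl.SpanCat (Type u₁)) ∧
    Dbl.HasStrongFiniteCoproducts.{u₁} (Dbl.SpanCat FintypeCat.{u₁}) := by
  refine ⟨fun S _ _ => ⟨fun h => ?_, fun h => ?_, fun h => ?_, fun h => ?_⟩, ?_, ?_⟩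
  · have := Dbl.HasCoproductsOfClass.of_all h
    exact Dbl.hasColaxCoproductsOf_spanCat _ S
  · have := Dbl.HasCoproductsOfClass.of_finite (S := S)
    exact Dbl.hasColaxCoproductsOf_spanCat _ S
  · exact Dbl.hasStrongCoproducts_spanCat h
  · exact Dbl.hasStrongFiniteCoproducts_spanCat
  · exact Dbl.hasStrongCoproducts_spanCat Dbl.infinitaryExtensive_type
  · have := Dbl.finitaryExtensive_fintypeCat.{u₁}
    exact Dbl.hasStrongFiniteCoproducts_spanCat
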